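/- Let $G=([n],E)$ be a finite simple graph on the vertex set $[n]=\{1,\dots,n\}$ such that the ordering $1,2,\dots,n$ is a perfect elimination ordering of $G$, i.e., every vertex $x$ induces a clique together with its neighbors that are smaller than $x$ (in particular, $G$ is chordal). An elimination tree for a connected graph is a rooted (unordered) tree on its vertices, consisting of a root $x$ whose children are the roots of elimination trees for the connected components of the graph minus $x$, one for each component. An elimination forest for $G$ is a set of elimination trees, one for each connected component of $G$; $\mathcal{E}(G)$ is the set of all of them. If $j$ is a child of $i$ in an elimination forest $F$ and $H$ is the subgraph of $G$ induced by the vertices of the subtree of $F$ rooted at $i$, then the rotation of the edge $\{i,j\}$ makes $j$ the parent of $i$ and puts $j$ in the former place of $i$; the subtrees of $i$ other than the one rooted at $j$ remain subtrees of $i$, and a subtree of $j$ remains a subtree of $j$, unless its vertices lie in the same connected component of $H-j$ as $i$, in which case it becomes a subtree of $i$. For $i<j$, this rotation, and likewise its reverse (the rotation of an edge $\{i,j\}$ where $i$ is a child of $j$), is called an up- or down-rotation of $j$. Algorithm R first visits the elimination forest $F_0$ obtained by removing the vertices in increasing order $1,2,\dots,n$. Then it repeatedly takes the most recently visited forest and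 the largest vertex $j$ that has an up- or down-rotation leading to an unvisited elimination forest, and it performs this rotation and visits the resulting forest. It terminates if no such vertex exists, or if more than one rotation edge for this vertex $j$ leads to an unvisited forest. Then Algorithm R visits every elimination forest in $\mathcal{E}(G)$ exactly once, and any two consecutively visited forests differ in a rotation (i.e., it produces a rotation Gray code for $\mathcal{E}(G)$). Moreover: (1) If $G$ is 2-connected (i.e., $n\ge 3$ and removing any vertex leaves a connected graph), then this Gray code is cyclic, i.e., the first and the last forest differ in a rotation; and the number of elimination forests of the subgraph $G^{[\nu]}$ of $G$ induced by $\{1,\dots,\nu\}$ is even for every $\nu=2,\dots,n$. (2) If $G$ is a tree with $n\ge 4$ vertices, then this Gray code is not cyclic, i.e., the first and the last forest do not differ in a rotation. -/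

import Mathlib

namespace ElimGray

variable {n : ℕ}

/-- `C` is the vertex set of a connected component of the subgraph of `G` induced by `S`. -/
def IsComponent (G : SimpleGraph (Fin n)) (S C : Set (Fin n)) : Prop :=
  Maximal (fun D : Set (Fin n) => D ⊆ S ∧ (G.induce D).Connected) C

/-- A rooted forest on the vertices is given by its parent map `p`, where `p v = none` says that
`v` is a root. `IsElimTree G p S x` says that the restriction of the forest to the vertex set `S`,
on which `G` is connected, is an elimination tree with root `x` for the subgraph of `G` induced by
`S`: the children of `x` are the roots of elimination trees for the connected components of the
subgraph induced by `S \ {x}`, one for each component. -/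
inductive IsElimTree (G : SimpleGraph (Fin n)) (p : Fin n → Option (Fin n)) :
    Set (Fin n) → Fin n → Prop
  | node (S : Set (Fin n)) (x : Fin n) (hS : (G.induce S).Connected) (hx : x ∈ S)
      (root : Set (Fin n) → Fin n)
      (parent : ∀ C, IsComponent G (S \ {x}) C → p (root C) = some x)
      (subtree : ∀ C, IsComponent G (S \ {x}) C → IsElimTree G p C (root C)) :
      IsElimTree G p S x

/-- The forest with parent map `p` is an elimination forest for `G`: it consists of one elimination
tree for each connected component of `G`. -/
def IsElimForest (G : SimpleGraph (Fin n)) (p : Fin n → Option (Fin n)) : Prop :=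
  ∀ C, IsComponent G Set.univ C → ∃ r, p r = none ∧ IsElimTree G p C r

/-- The set of all elimination forests for `G`. -/
def ElimForest (G : SimpleGraph (Fin n)) : Type :=
  {p : Fin n → Option (Fin n) // IsElimForest G p}

noncomputable instance (G : SimpleGraph (Fin n)) : Fintype (ElimForest G) :=
  @Subtype.fintype _ _ (Classical.decPred _) inferInstance

/-- The vertices in the subtree rooted at `i`. -/
def descendants (p : Fin n → Option (Fin n)) (i : Fin n) : Set (Fin n) :=
  {v | Relation.ReflTransGen (fun u w => p u = some w) v i}

open Classical in
/-- The result of rotating the edge between `i` and its child `j`: `j` takes the place of `i`, and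
`i` becomes a child of `j`. A subtree of `j`, with root `v`, moves to `i` if its vertices lie in the
connected component that contains `i` after removing `j` from the subgraph `H` of `G` that is
induced by the subtree of `i`. All other parents stay the same. -/
noncomputable def rotate (G : SimpleGraph (Fin n)) (p : Fin n → Option (Fin n)) (i j : Fin n) :
    Fin n → Option (Fin n) := fun v =>
  if v = j then p i
  else if v = i then some j
  else if p v = some j ∧ ∃ C, IsComponent G (descendants p i \ {j}) C ∧ i ∈ C ∧
      descendants p v ⊆ C then some i
  else p v

/-- `F'` arises from `F` by the rotation of the edge `{i, j}` of `F`, where `i` is the parent of `j`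
or `j` is the parent of `i`. -/
def IsRotation {G : SimpleGraph (Fin n)} (F F' : ElimForest G) (i j : Fin n) : Prop :=
  (F.1 j = some i ∧ F'.1 = rotate G F.1 i j) ∨ (F.1 i = some j ∧ F'.1 = rotate G F.1 j i)

/-- `F'` arises from `F` by a single rotation. -/
def RotationAdj {G : SimpleGraph (Fin n)} (F F' : ElimForest G) : Prop :=
  ∃ i j, IsRotation F F' i j

/-- In the forest `F`, after the forests in `L` were visited, the rotation of the edge `{i, j}`,
where `i < j`, is an up- or down-rotation of `j` that creates the unvisited forest `F'`. -/
def IsOption {G : SimpleGraph (Fin n)} (L : List (ElimForest G)) (F F' : ElimForest G)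
    (i j : Fin n) : Prop :=
  i < j ∧ IsRotation F F' i j ∧ F' ∉ L

/-- The greedy rule: `L` lists the forests visited so far, in this order. The next forest `F'` is
an unvisited one that is created from the last forest in `L` by an up- or down-rotation of the
largest possible vertex `j`, provided that there is only one choice for the rotation edge. -/
def IsNext {G : SimpleGraph (Fin n)} (L : List (ElimForest G)) (F' : ElimForest G) : Prop :=
  ∃ F, L.getLast? = some F ∧ ∃ i j, IsOption L F F' i j ∧
    (∀ k, j < k → ¬ ∃ i' F'', IsOption L F F'' i' k) ∧
    (∀ i' F'', IsOption L F F'' i' j → i' = i)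

open Classical in
theorem unvisited_lt {G : SimpleGraph (Fin n)} {L : List (ElimForest G)} {F' : ElimForest G}
    (h : IsNext L F') :
    (Finset.univ.filter (fun X => X ∉ L ++ [F'])).card
      < (Finset.univ.filter (fun X => X ∉ L)).card := by
  obtain ⟨F, -, i, j, ⟨-, -, hF'⟩, -, -⟩ := h
  apply Finset.card_lt_card
  rw [Finset.ssubset_iff_of_subset]
  · exact ⟨F', by simpa using hF', by simp⟩
  · intro X hX
    simp only [Finset.mem_filter, Finset.mem_univ, true_and, List.mem_append, not_or] at hX ⊢
    exact hX.1

open Classical in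
/-- The algorithm, continued from the list `L` of visited forests until it terminates. Its value is
the list of all visited forests. -/
noncomputable def continueGreedy {G : SimpleGraph (Fin n)} (L : List (ElimForest G)) :
    List (ElimForest G) :=
  if h : ∃ F', IsNext L F' then continueGreedy (L ++ [h.choose]) else L
termination_by (Finset.univ.filter (fun X => X ∉ L)).card
decreasing_by exact unvisited_lt h.choose_spec

open Classical in
/-- The vertices that are removed before `v` from the current connected component of `v`, if the
vertices are removed in increasing order. -/
noncomputable def removedBefore (G : SimpleGraph (Fin n)) (v : Fin n) : Finset (Fin n) :=
  Finset.univ.filter (fun u => u < v ∧ ∃ C, IsComponent G (Set.Ici u) C ∧ u ∈ C ∧ v ∈ C)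

open Classical in
/-- The forest obtained by removing the vertices in increasing order: the parent of `v` is the last
vertex removed before `v` from the component that contains `v` at that time. -/
noncomputable def increasingParent (G : SimpleGraph (Fin n)) (v : Fin n) : Option (Fin n) :=
  if h : (removedBefore G v).Nonempty then some ((removedBefore G v).max' h) else none

theorem IsComponent.subset_of_inter {G : SimpleGraph (Fin n)} {S C D : Set (Fin n)}
    (hC : IsComponent G S C) (hD : D ⊆ S) (hconn : (G.induce D).Connected)
    (hne : (C ∩ D).Nonempty) : D ⊆ C := by
  have h := hC.2 (y := C ∪ D) ⟨Set.union_subset hC.1.1 hD,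
    SimpleGraph.induce_union_connected hC.1.2.preconnected hconn.preconnected hne⟩
    Set.subset_union_left
  exact Set.subset_union_right.trans h

theorem IsComponent.exists_least {G : SimpleGraph (Fin n)} {S C : Set (Fin n)}
    (hC : IsComponent G S C) : ∃ r ∈ C, ∀ y ∈ C, r ≤ y := by
  obtain ⟨⟨y, hy⟩⟩ := hC.1.2.nonempty
  obtain ⟨r, hr, h⟩ := wellFounded_lt.has_min C ⟨y, hy⟩
  exact ⟨r, hr, fun y hy => not_lt.1 (h y hy)⟩

theorem isElimTree_increasing (G : SimpleGraph (Fin n)) (m : ℕ) :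
    ∀ (x : Fin n) (S : Set (Fin n)), n - x.1 ≤ m → IsComponent G (Set.Ici x) S → x ∈ S →
      IsElimTree G (increasingParent G) S x := by
  classical
  induction m with
  | zero => intro x S h; have := x.2; omega
  | succ m ih =>
    intro x S hm hS hx
    have key : ∀ C, IsComponent G (S \ {x}) C → ∃ r, increasingParent G r = some x ∧
        IsElimTree G (increasingParent G) C r := by
      intro C hC
      obtain ⟨r, hr, hmin⟩ := hC.exists_least
      have hrS := hC.1.1 hr
      have hxr : x < r := lt_of_le_of_ne (hS.1.1 hrS.1) (fun h => hrS.2 h.symm)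
      have hinto : ∀ D u, x < u → D ⊆ Set.Ici u → (G.induce D).Connected → r ∈ D → D ⊆ C := by
        intro D u hu hDu hD hrD
        have hDS : D ⊆ S := hS.subset_of_inter
          (fun y hy => hu.le.trans (hDu hy)) hD ⟨r, hrS.1, hrD⟩
        refine hC.subset_of_inter (fun y hy => ⟨hDS hy, ?_⟩) hD ⟨r, hr, hrD⟩
        intro hyx
        rw [Set.mem_singleton_iff] at hyx
        subst hyx
        exact absurd (hDu hy) (not_le.2 hu)
      refine ⟨r, ?_, ih r C ?_ ⟨⟨hmin, hC.1.2⟩, ?_⟩ hr⟩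
      · have hmem : x ∈ removedBefore G r := by
          simp only [removedBefore, Finset.mem_filter, Finset.mem_univ, true_and]
          exact ⟨hxr, S, hS, hx, hrS.1⟩
        have hne : (removedBefore G r).Nonempty := ⟨x, hmem⟩
        rw [increasingParent, dif_pos hne]
        congr 1
        refine le_antisymm (Finset.max'_le _ _ _ ?_) (Finset.le_max' _ _ hmem)
        intro u hu
        simp only [removedBefore, Finset.mem_filter, Finset.mem_univ, true_and] at hu
        obtain ⟨hur, E, hE, huE, hrE⟩ := hu
        by_contra hux
        exact absurd (hmin u (hinto E u (not_le.1 hux) hE.1.1 hE.1.2 hrE huE)) (not_le.2 hur)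
      · have := Fin.lt_def.1 hxr
        omega
      · intro D hD hCD
        exact hinto D r hxr hD.1 hD.2 (hCD hr)
    have key' : ∀ C, ∃ r, IsComponent G (S \ {x}) C → increasingParent G r = some x ∧
        IsElimTree G (increasingParent G) C r := by
      intro C
      by_cases hC : IsComponent G (S \ {x}) C
      · obtain ⟨r, h⟩ := key C hC
        exact ⟨r, fun _ => h⟩
      · exact ⟨x, fun h => absurd h hC⟩
    choose root h using key'
    exact IsElimTree.node S x hS.1.2 hx root (fun C hC => (h C hC).1) (fun C hC => (h C hC).2)

theorem isElimForest_increasing (G : SimpleGraph (Fin n)) :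
    IsElimForest G (increasingParent G) := by
  classical
  intro C hC
  obtain ⟨r, hr, hmin⟩ := hC.exists_least
  refine ⟨r, ?_, isElimTree_increasing G n r C (Nat.sub_le _ _)
    ⟨⟨hmin, hC.1.2⟩, fun D hD hCD =>
      hC.subset_of_inter (Set.subset_univ _) hD.2 ⟨r, hr, hCD hr⟩⟩ hr⟩
  rw [increasingParent, dif_neg]
  rintro ⟨u, hu⟩
  simp only [removedBefore, Finset.mem_filter, Finset.mem_univ, true_and] at hu
  obtain ⟨hur, E, hE, huE, hrE⟩ := hu
  exact absurd (hmin u (hC.subset_of_inter (Set.subset_univ _) hE.1.2 ⟨r, hr, hrE⟩ huE))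
    (not_le.2 hur)

/-- The initial elimination forest, obtained by removing the vertices in increasing order. -/
noncomputable def initialForest (G : SimpleGraph (Fin n)) : ElimForest G :=
  ⟨increasingParent G, isElimForest_increasing G⟩

/-- The list of elimination forests visited by the greedy algorithm when it is initialized with the
forest obtained by removing the vertices in increasing order. -/
noncomputable def greedyRotations (G : SimpleGraph (Fin n)) : List (ElimForest G) :=
  continueGreedy [initialForest G]

/-- The vertices `0, 1, …, n - 1` of `G`, in this order, are a perfect elimination ordering: every
vertex induces a clique together with its neighbors that come before it. Such a `G` is chordal. -/
def IsPEO (G : SimpleGraph (Fin n)) : Prop :=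
  ∀ x, G.IsClique (insert x {y | y < x ∧ G.Adj x y})

/-- `G` has at least three vertices and removing any vertex leaves a connected graph. -/
def IsTwoConnected (G : SimpleGraph (Fin n)) : Prop :=
  3 ≤ n ∧ ∀ v, (G.induce {v}ᶜ).Connected

/-- The subgraph of `G` induced by the first `ν` vertices. -/
def prefixGraph (G : SimpleGraph (Fin n)) (ν : ℕ) (h : ν ≤ n) : SimpleGraph (Fin ν) :=
  G.comap (Fin.castLE h)

/-- The list contains every elimination forest for `G` exactly once, and any two consecutive ones
differ in a rotation. -/
def IsRotationGrayCode {G : SimpleGraph (Fin n)} (L : List (ElimForest G)) : Prop :=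
  (∀ F, F ∈ L) ∧ L.Nodup ∧ L.IsChain RotationAdj

/-- The first and the last forest in the list differ in a rotation. -/
def IsCyclicList {G : SimpleGraph (Fin n)} (L : List (ElimForest G)) : Prop :=
  ∃ F F', L.head? = some F ∧ L.getLast? = some F' ∧ RotationAdj F F'

end ElimGray

/-! The proof is an induction along the perfect elimination ordering. An elimination forest is
encoded by the family of its descendant sets `D v`; the families that occur are exactly those
satisfying `Nested` (`IsElimForest.nested`, `Nested.exists_elimForest`). In this language a rotation
of `{i, j}` changes only the sets of `i` and `j`, and `j` receives the old set of `i`; the new set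
of `i` is then forced (`Nested.rot_det`, `isRotation_iff`). All graphs live on `Fin n`: in `cut G m`
the vertices from `m` on are isolated, so the induction never changes the vertex type.

Let `m` be the next vertex and `N` the clique of its smaller neighbors. If `N` is empty, nothing
changes. Otherwise, since `m` is simplicial, deleting it sends elimination forests of the larger
graph to those of the smaller one. The vertices of `D` whose subtrees meet `N` form a chain, and the
forests over `D` arise by inserting `m` somewhere along this chain or as a leaf below it;
neighboring places differ in a rotation of `m`. `zigzag` runs through these fibers in the order of
the smaller list, sweeping `m` alternately up and down. Between two fibers `m` stays at one end of
its chain, and there every rotation of `D` lifts (`Extends.edge_extreme`).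

This list is the greedy one. Vertices after `m` are isolated, so rotations of `m` have priority, and
inside a fiber only one direction is unvisited (`Extends.step_of_rot`). Once the fiber is exhausted,
rotations of `m` lead to visited forests and all others project to rotations of `D`, so the greedy
choice is inherited from the smaller graph (`Extends.step_extreme`). Every choice is unique, hence
the algorithm produces exactly this list (`continueGreedy_eq`).

The list starts with `m` at the bottom. It ends with `m` at the bottom if the smaller list has even
length, and at the top otherwise. In the even case the new list is cyclic iff the old one is. In the
odd case a closing rotation would have to involve `m`, so the first and last forests below would
coincide and the smaller list would be a singleton. For 2-connected `G` all prefixes from two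
vertices on have an even number of forests (swap the root with its only child), and cyclicity
propagates from the two forests of an edge. For a tree the first three vertices induce a path with
five elimination trees; this odd number destroys cyclicity at the fourth vertex, and it never
returns. -/

namespace ElimGray

variable {n : ℕ}

/-! ### Connectivity of vertex sets and components. -/

/-- Connectivity of the vertex set `S`, expressed by the absence of cuts. -/
def Conn {V : Type*} (H : SimpleGraph V) (S : Set V) : Prop :=
  S.Nonempty ∧ ∀ A ⊆ S, A.Nonempty → (∀ a ∈ A, ∀ b ∈ S, H.Adj a b → b ∈ A) → S ⊆ A

theorem conn_iff {V : Type*} {H : SimpleGraph V} {S : Set V} :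
    Conn H S ↔ (H.induce S).Connected := by
  constructor
  · rintro ⟨⟨a, ha⟩, h⟩
    have key := h {x | ∃ hx : x ∈ S, (H.induce S).Reachable ⟨a, ha⟩ ⟨x, hx⟩}
      (fun x hx => hx.1) ⟨a, ha, SimpleGraph.Reachable.refl _⟩ (by
        rintro x ⟨hx, hr⟩ b hb hadj
        exact ⟨hb, hr.trans (SimpleGraph.Adj.reachable (by simpa using hadj))⟩)
    have : Nonempty S := ⟨⟨a, ha⟩⟩
    refine SimpleGraph.Connected.mk fun u v => ?_
    obtain ⟨_, hu⟩ := key u.2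
    obtain ⟨_, hv⟩ := key v.2
    exact hu.symm.trans hv
  · intro h
    obtain ⟨⟨s, hs⟩⟩ := h.nonempty
    refine ⟨⟨s, hs⟩, ?_⟩
    rintro A hA ⟨a, ha⟩ hcl x hx
    have hr := (SimpleGraph.reachable_iff_reflTransGen _ _).1 (h.preconnected ⟨a, hA ha⟩ ⟨x, hx⟩)
    suffices ∀ y : S, Relation.ReflTransGen (H.induce S).Adj ⟨a, hA ha⟩ y → y.1 ∈ A from
      this _ hr
    intro y hy
    induction hy with
    | refl => exact ha
    | tail _ hbc ih => exact hcl _ ih _ (Subtype.property _) (by simpa using hbc)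

section Conn

variable {V : Type*} {H H' : SimpleGraph V} {S : Set V}

theorem Conn.of_adj (h : Conn H S) (hadj : ∀ a ∈ S, ∀ b ∈ S, H.Adj a b → H'.Adj a b) :
    Conn H' S :=
  ⟨h.1, fun A hA hne hcl => h.2 A hA hne fun a ha b hb hab =>
    hcl a ha b hb (hadj a (hA ha) b hb hab)⟩

theorem conn_singleton (v : V) : Conn H {v} := by
  refine ⟨⟨v, rfl⟩, ?_⟩
  rintro A hA ⟨a, ha⟩ - x hx
  have := hA ha
  simp only [Set.mem_singleton_iff] at this hx
  rwa [hx, ← this]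

theorem Conn.exists_adj_of_subset (h : Conn H S) {A : Set V} (hA : A ⊆ S) (hne : A.Nonempty)
    (hS : ¬ S ⊆ A) : ∃ a ∈ A, ∃ b ∈ S, b ∉ A ∧ H.Adj a b := by
  by_contra hcon
  push Not at hcon
  refine hS (h.2 A hA hne fun a ha b hb hab => ?_)
  by_contra hbA
  exact hcon a ha b hb hbA hab

theorem Conn.exists_adj (h : Conn H S) {u v : V} (hv : v ∈ S) (hu : u ∈ S) (huv : u ≠ v) :
    ∃ b ∈ S, H.Adj v b := by
  obtain ⟨a, ha, b, hb, -, hab⟩ := h.exists_adj_of_subset (A := {v}) (by simpa using hv) ⟨v, rfl⟩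
    (fun hS => huv (by simpa using hS hu))
  rw [Set.mem_singleton_iff] at ha
  exact ⟨b, hb, ha ▸ hab⟩

theorem Conn.insert (h : Conn H S) {a v : V} (ha : a ∈ S) (hav : H.Adj a v) :
    Conn H (insert v S) := by
  refine ⟨⟨v, by simp⟩, ?_⟩
  intro A hA hne hcl
  have haA : a ∈ A := by
    obtain ⟨y, hy⟩ := hne
    rcases hA hy with rfl | hyS
    · exact hcl _ hy a (by simp [ha]) hav.symm
    · refine h.2 (A ∩ S) Set.inter_subset_right ⟨y, hy, hyS⟩ ?_ ha |>.1
      rintro c ⟨hc, _⟩ b hb hcb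
      exact ⟨hcl c hc b (by simp [hb]) hcb, hb⟩
  have hvA : v ∈ A := hcl a haA v (by simp) hav
  have := h.2 (A ∩ S) Set.inter_subset_right ⟨a, haA, ha⟩ (by
    rintro c ⟨hc, _⟩ b hb hcb
    exact ⟨hcl c hc b (by simp [hb]) hcb, hb⟩)
  intro x hx
  rcases hx with rfl | hx
  · exact hvA
  · exact (this hx).1

/-- Removing a simplicial vertex does not destroy connectivity. -/
theorem Conn.diff_singleton (h : Conn H S) {m : V} (hne : (S \ {m}).Nonempty)
    (hm : ∀ a ∈ S, ∀ b ∈ S, H.Adj m a → H.Adj m b → a ≠ b → H.Adj a b) : Conn H (S \ {m}) := by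
  refine ⟨hne, ?_⟩
  intro A hA hAne hcl x hx
  by_cases hmS : m ∈ S
  · by_cases hex : ∃ a ∈ A, H.Adj m a
    · obtain ⟨a, ha, hma⟩ := hex
      -- The neighbors of `m` in `S` are equal or adjacent to `a`, so they already lie in `A` (apart
      -- from `m` itself, the only vertex added).
      have := h.2 (Insert.insert m A) (Set.insert_subset hmS (hA.trans Set.sdiff_subset))
        ⟨m, by simp⟩ (by
          rintro c hc b hb hcb
          by_cases hbm : b = m
          · simp [hbm]
          refine Or.inr ?_
          rcases hc with rfl | hc
          · by_cases hab : a = b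
            · exact hab ▸ ha
            · exact hcl a ha b ⟨hb, hbm⟩ (hm a (hA ha).1 b hb hma hcb hab)
          · exact hcl c hc b ⟨hb, hbm⟩ hcb)
      exact (this hx.1).resolve_left hx.2
    · push Not at hex
      refine h.2 A (hA.trans Set.sdiff_subset) hAne ?_ hx.1
      intro a ha b hb hab
      by_cases hbm : b = m
      · exact absurd (hbm ▸ hab).symm (hex a ha)
      · exact hcl a ha b ⟨hb, hbm⟩ hab
  · exact h.2 A (hA.trans Set.sdiff_subset) hAne
      (fun a ha b hb hab => hcl a ha b ⟨hb, fun hbm => hmS (hbm ▸ hb)⟩ hab) hx.1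

end Conn

section Component

variable {H : SimpleGraph (Fin n)} {S C : Set (Fin n)}

theorem isComponent_iff :
    IsComponent H S C ↔ C ⊆ S ∧ Conn H C ∧ ∀ a ∈ C, ∀ b ∈ S, H.Adj a b → b ∈ C := by
  constructor
  · intro h
    have hC := conn_iff.2 h.1.2
    refine ⟨h.1.1, hC, fun a ha b hb hab => ?_⟩
    exact h.2 (y := insert b C) ⟨Set.insert_subset hb h.1.1, conn_iff.1 (hC.insert ha hab)⟩
      (Set.subset_insert _ _) (Set.mem_insert _ _)
  · rintro ⟨hS, hC, hcl⟩
    refine ⟨⟨hS, conn_iff.1 hC⟩, ?_⟩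
    rintro E ⟨hES, hE⟩ hCE
    exact (conn_iff.2 hE).2 C hCE hC.1 fun a ha b hb => hcl a ha b (hES hb)

theorem exists_isComponent {v : Fin n} (hv : v ∈ S) : ∃ C, IsComponent H S C ∧ v ∈ C := by
  obtain ⟨C, hvC, hC⟩ := (Set.toFinite {D : Set (Fin n) | D ⊆ S ∧ (H.induce D).Connected})
    |>.exists_le_maximal (a := {v}) ⟨by simpa using hv, conn_iff.1 (conn_singleton v)⟩
  exact ⟨C, hC, hvC rfl⟩

theorem IsComponent.eq_of_mem {E : Set (Fin n)} (hC : IsComponent H S C) (hE : IsComponent H S E)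
    {v : Fin n} (hvC : v ∈ C) (hvE : v ∈ E) : C = E :=
  (hE.subset_of_inter hC.1.1 hC.1.2 ⟨v, hvE, hvC⟩).antisymm
    (hC.subset_of_inter hE.1.1 hE.1.2 ⟨v, hvC, hvE⟩)

end Component

/-! ### Elimination forests and rotations as families of descendant sets. -/

/-- The descendant sets `D v` of an elimination forest for `H`. -/
structure Nested (H : SimpleGraph (Fin n)) (D : Fin n → Set (Fin n)) : Prop where
  self : ∀ v, v ∈ D v
  trans : ∀ {u v}, u ∈ D v → D u ⊆ D v
  antisymm : ∀ {u v}, u ∈ D v → v ∈ D u → u = v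
  laminar : ∀ {u v w}, w ∈ D u → w ∈ D v → u ∈ D v ∨ v ∈ D u
  adj : ∀ {u v}, H.Adj u v → u ∈ D v ∨ v ∈ D u
  conn : ∀ v, Conn H (D v)

/-- `i` is the parent of `j` in the forest with descendant sets `D`. -/
def Cov (D : Fin n → Set (Fin n)) (i j : Fin n) : Prop :=
  j ∈ D i ∧ j ≠ i ∧ ∀ u, j ∈ D u → u ≠ j → i ∈ D u

/-- Rotation of the edge between `i` and its child `j`, in terms of descendant sets. -/
def Rot (D D' : Fin n → Set (Fin n)) (i j : Fin n) : Prop :=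
  i ≠ j ∧ D' j = D i ∧ ∀ w, w ≠ i → w ≠ j → D' w = D w

/-- Leaving `D' i` open in `Rot` is what makes the relation reversible this easily; facts about a
rotation thus apply to its reverse as well. -/
theorem Rot.symm {D D' : Fin n → Set (Fin n)} {i j : Fin n} (h : Rot D D' i j) : Rot D' D j i :=
  ⟨h.1.symm, h.2.1.symm, fun w h1 h2 => (h.2.2 w h2 h1).symm⟩

namespace Nested

variable {H : SimpleGraph (Fin n)} {D D' D'' : Fin n → Set (Fin n)}

theorem inj (hD : Nested H D) {u v : Fin n} (h : D u = D v) : u = v :=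
  hD.antisymm (h ▸ hD.self u) (h ▸ hD.self v)

/-- An edge leaving `D c` inside `S` would, by comparability of its ends and laminarity, put its
outer end above `c`, against maximality. -/
theorem isComponent_of_top (hD : Nested H D) {S : Set (Fin n)} (hS : ∀ b ∈ S, D b ⊆ S) {c : Fin n}
    (hc : c ∈ S) (htop : ∀ b ∈ S, c ∈ D b → b = c) : IsComponent H S (D c) := by
  refine isComponent_iff.2 ⟨hS c hc, hD.conn c, fun a ha b hb hab => ?_⟩
  rcases hD.adj hab with h | h
  · rcases hD.laminar ha h with h' | h'
    · rw [htop b hb h']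
      exact hD.self c
    · exact h'
  · exact hD.trans ha h

theorem exists_top (hD : Nested H D) {S : Set (Fin n)} {y : Fin n} (hy : y ∈ S) :
    ∃ c ∈ S, y ∈ D c ∧ ∀ b ∈ S, c ∈ D b → b = c := by
  obtain ⟨c, ⟨hcS, hyc⟩, hmax⟩ := Set.exists_max_image {c | c ∈ S ∧ y ∈ D c}
    (fun c => (D c).ncard) (Set.toFinite _) ⟨y, hy, hD.self y⟩
  refine ⟨c, hcS, hyc, fun b hb hcb => ?_⟩
  have h1 := hD.trans hcb
  exact (hD.inj (Set.eq_of_subset_of_ncard_le h1 (hmax b ⟨hb, h1 hyc⟩) (Set.toFinite _))).symm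

theorem eq_of_isComponent (hD : Nested H D) {S C : Set (Fin n)} (hS : ∀ b ∈ S, D b ⊆ S)
    (hC : IsComponent H S C) : ∃ c ∈ S, (∀ b ∈ S, c ∈ D b → b = c) ∧ C = D c := by
  obtain ⟨y, hy⟩ := (conn_iff.2 hC.1.2).1
  obtain ⟨c, hc, hyc, htop⟩ := hD.exists_top (hC.1.1 hy)
  exact ⟨c, hc, htop, hC.eq_of_mem (hD.isComponent_of_top hS hc htop) hy hyc⟩

theorem cov_unique (hD : Nested H D) {i i' j : Fin n} (h : Cov D i j) (h' : Cov D i' j) :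
    i = i' :=
  hD.antisymm (h.2.2 i' h'.1 h'.2.1.symm) (h'.2.2 i h.1 h.2.1.symm)

theorem exists_cov (hD : Nested H D) {u v : Fin n} (hv : v ∈ D u) (huv : u ≠ v) :
    ∃ i, Cov D i v := by
  obtain ⟨i, ⟨hiv, hi⟩, hmin⟩ := Set.exists_min_image {c | c ≠ v ∧ v ∈ D c}
    (fun c => (D c).ncard) (Set.toFinite _) ⟨u, huv, hv⟩
  refine ⟨i, hi, hiv.symm, fun w hw hwv => ?_⟩
  rcases hD.laminar hi hw with h | h
  · exact h
  · rw [Set.eq_of_subset_of_ncard_le (hD.trans h) (hmin w ⟨hwv, hw⟩) (Set.toFinite _)]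
    exact hD.self i

theorem diff_closed (hD : Nested H D) (i : Fin n) : ∀ b ∈ D i \ {i}, D b ⊆ D i \ {i} := by
  rintro b ⟨hb, hbi⟩ x hx
  refine ⟨hD.trans hb hx, ?_⟩
  rintro rfl
  exact hbi (hD.antisymm hb hx)

theorem isComponent_of_cov (hD : Nested H D) {i j : Fin n} (h : Cov D i j) :
    IsComponent H (D i \ {i}) (D j) := by
  refine hD.isComponent_of_top (hD.diff_closed i) ⟨h.1, h.2.1⟩ ?_
  rintro b ⟨hb, hbi⟩ hjb
  by_contra hbj
  exact hbi (hD.antisymm hb (h.2.2 b hjb hbj))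

/-- `D j` is a component of `D i \ {i}`, so only an edge at `i` can attach it to the rest of the
connected set `D i`. -/
theorem cov_adj (hD : Nested H D) {i j : Fin n} (h : Cov D i j) : ∃ w ∈ D j, H.Adj i w := by
  have hcomp := isComponent_iff.1 (hD.isComponent_of_cov h)
  obtain ⟨a, ha, b, hb, hbj, hab⟩ := (hD.conn i).exists_adj_of_subset (hD.trans h.1)
    ⟨j, hD.self j⟩ (fun hs => h.2.1 (hD.antisymm h.1 (hs (hD.self i))))
  by_cases hbi : b = i
  · exact ⟨a, ha, hbi ▸ hab.symm⟩
  · exact absurd (hcomp.2.2 a ha b ⟨hb, hbi⟩ hab) hbj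

theorem cov_of_rot (hD : Nested H D) (hD' : Nested H D') {i j : Fin n} (h : Rot D D' i j) :
    Cov D i j := by
  refine ⟨h.2.1 ▸ hD'.self j, h.1.symm, fun u hu huj => ?_⟩
  by_cases hui : u = i
  · exact hui ▸ hD.self i
  · have := hD'.trans ((h.2.2 u hui huj).symm ▸ hu)
    rw [h.2.1, h.2.2 u hui huj] at this
    exact this (hD.self i)

/-- After the rotation `i` is a child of `j`, so its set must be the component of `i` in `D i \
{j}`; nothing is left to choose. -/
theorem rot_det (hD : Nested H D) (hD' : Nested H D') (hD'' : Nested H D'') {i j : Fin n}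
    (h' : Rot D D' i j) (h'' : Rot D D'' i j) : D' = D'' := by
  have c' := hD'.isComponent_of_cov (hD'.cov_of_rot hD h'.symm)
  have c'' := hD''.isComponent_of_cov (hD''.cov_of_rot hD h''.symm)
  rw [h'.2.1] at c'
  rw [h''.2.1] at c''
  funext w
  by_cases hi : w = i
  · subst hi
    exact c'.eq_of_mem c'' (hD'.self w) (hD''.self w)
  · by_cases hj : w = j
    · rw [hj, h'.2.1, h''.2.1]
    · rw [h'.2.2 w hi hj, h''.2.2 w hi hj]

/-- Let `j` inherit `D i` and give `i` its component `C` in `D i \ {j}`. Any other subtree rooted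
inside `D i` is connected and avoids `j`, hence lies in `C` or is disjoint from it; this keeps the
family laminar. -/
theorem exists_rot (hD : Nested H D) {i j : Fin n} (h : Cov D i j) :
    ∃ D', Nested H D' ∧ Rot D D' i j := by
  have hij : i ≠ j := h.2.1.symm
  obtain ⟨C, hC, hiC⟩ := exists_isComponent (H := H) (S := D i \ {j}) (v := i)
    ⟨hD.self i, hij⟩
  obtain ⟨hCS, hCc, hCcl⟩ := isComponent_iff.1 hC
  classical
  obtain ⟨D', hj, hi, ho⟩ : ∃ D' : Fin n → Set (Fin n), D' j = D i ∧ D' i = C ∧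
      ∀ w, w ≠ i → w ≠ j → D' w = D w :=
    ⟨fun w => if w = j then D i else if w = i then C else D w, by simp, by simp [hij],
      fun w h1 h2 => by simp [h1, h2]⟩
  have hsub : ∀ u, u ≠ i → u ≠ j → u ∈ D i → D u ⊆ D i \ {j} := by
    intro u h1 h2 hu x hx
    refine ⟨hD.trans hu hx, ?_⟩
    rintro rfl
    exact h1 (hD.antisymm hu (h.2.2 u hx h2))
  have hsubC : ∀ u w, u ≠ i → u ≠ j → u ∈ D i → w ∈ D u → w ∈ C → D u ⊆ C :=
    fun u w h1 h2 hu hw hwC => hC.subset_of_inter (hsub u h1 h2 hu) (conn_iff.1 (hD.conn u))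
      ⟨w, hwC, hw⟩
  have hlam : ∀ u w, u ≠ i → u ≠ j → w ∈ D u → w ∈ C → u ∈ C ∨ i ∈ D u := by
    intro u w h1 h2 hw hwC
    rcases hD.laminar hw (hCS hwC).1 with h' | h'
    · exact Or.inl (hsubC u w h1 h2 h' hw hwC (hD.self u))
    · exact Or.inr h'
  have hij' : i ∈ D' j := hj ▸ hD.self i
  have hlamj : ∀ u w, u ≠ i → u ≠ j → w ∈ D u → w ∈ D i → u ∈ D i ∨ j ∈ D u := by
    intro u w h1 h2 hw hw'
    rcases hD.laminar hw hw' with h' | h'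
    · exact Or.inl h'
    · exact Or.inr (hD.trans h' h.1)
  have hadji : ∀ u, u ≠ i → u ≠ j → H.Adj i u → u ∈ C ∨ i ∈ D u := by
    intro u h1 h2 hiu
    rcases hD.adj hiu with h' | h'
    · exact Or.inr h'
    · exact Or.inl (hCcl i hiC u ⟨h', h2⟩ hiu)
  have hadjj : ∀ u, H.Adj j u → u ∈ D i ∨ j ∈ D u := by
    intro u hiu
    rcases hD.adj hiu with h' | h'
    · exact Or.inr h'
    · exact Or.inl (hD.trans h.1 h')
  refine ⟨D', ⟨?_, ?_, ?_, ?_, ?_, ?_⟩, hij, hj, ho⟩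
  · intro v
    by_cases h1 : v = i
    · rw [h1, hi]; exact hiC
    by_cases h2 : v = j
    · rw [h2, hj]; exact h.1
    · rw [ho v h1 h2]; exact hD.self v
  · intro u v huv
    by_cases v1 : v = i
    · subst v1
      by_cases u1 : u = v
      · rw [u1]
      rw [hi] at huv ⊢
      have u2 : u ≠ j := (hCS huv).2
      rw [ho u u1 u2]
      exact hsubC u u u1 u2 (hCS huv).1 (hD.self u) huv
    by_cases v2 : v = j
    · subst v2
      by_cases u2 : u = v
      · rw [u2]
      rw [hj] at huv ⊢
      by_cases u1 : u = i
      · rw [u1, hi]; exact hCS.trans Set.sdiff_subset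
      rw [ho u u1 u2]
      exact hD.trans huv
    rw [ho v v1 v2] at huv ⊢
    by_cases u1 : u = i
    · rw [u1, hi]; exact (hCS.trans Set.sdiff_subset).trans (hD.trans (u1 ▸ huv))
    by_cases u2 : u = j
    · rw [u2, hj]; exact hD.trans (h.2.2 v (u2 ▸ huv) v2)
    rw [ho u u1 u2]
    exact hD.trans huv
  · have key1 : ∀ v, v ≠ i → v ≠ j → i ∈ D v → v ∈ C → False := fun v v1 v2 a b =>
      v1 (hD.antisymm (hCS b).1 a)
    have key2 : ∀ v, v ≠ i → v ≠ j → j ∈ D v → v ∈ D i → False := fun v v1 v2 a b =>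
      v1 (hD.antisymm b (h.2.2 v a v2))
    have key3 : j ∉ C := fun hj => (hCS hj).2 rfl
    intro u v huv hvu
    by_cases u1 : u = i
    · by_cases v1 : v = i
      · rw [u1, v1]
      by_cases v2 : v = j
      · rw [u1, v2, hi] at hvu; exact absurd hvu key3
      · rw [ho v v1 v2, u1] at huv; rw [u1, hi] at hvu; exact (key1 v v1 v2 huv hvu).elim
    by_cases u2 : u = j
    · by_cases v2 : v = j
      · rw [u2, v2]
      by_cases v1 : v = i
      · rw [u2, v1, hi] at huv; exact absurd huv key3
      · rw [ho v v1 v2, u2] at huv; rw [u2, hj] at hvu; exact (key2 v v1 v2 huv hvu).elim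
    rw [ho u u1 u2] at hvu
    by_cases v1 : v = i
    · rw [v1, hi] at huv; exact (key1 u u1 u2 (v1 ▸ hvu) huv).elim
    by_cases v2 : v = j
    · rw [v2, hj] at huv; exact (key2 u u1 u2 (v2 ▸ hvu) huv).elim
    rw [ho v v1 v2] at huv
    exact hD.antisymm huv hvu
  · intro u v w hu hv
    by_cases u1 : u = i
    · by_cases v1 : v = i
      · rw [u1, v1, hi]; exact Or.inl hiC
      by_cases v2 : v = j
      · rw [u1, v2]; exact Or.inl hij'
      · rw [u1, ho v v1 v2, hi]
        rw [u1, hi] at hu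
        rw [ho v v1 v2] at hv
        exact (hlam v w v1 v2 hv hu).symm
    by_cases u2 : u = j
    · by_cases v2 : v = j
      · rw [u2, v2, hj]; exact Or.inl h.1
      by_cases v1 : v = i
      · rw [u2, v1]; exact Or.inr hij'
      · rw [u2, ho v v1 v2, hj]
        rw [u2, hj] at hu
        rw [ho v v1 v2] at hv
        exact (hlamj v w v1 v2 hv hu).symm
    rw [ho u u1 u2] at hu ⊢
    by_cases v1 : v = i
    · rw [v1, hi] at hv ⊢; exact hlam u w u1 u2 hu hv
    by_cases v2 : v = j
    · rw [v2, hj] at hv ⊢; exact hlamj u w u1 u2 hu hv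
    rw [ho v v1 v2] at hv ⊢
    exact hD.laminar hu hv
  · intro u v huv
    by_cases u1 : u = i
    · by_cases v1 : v = i
      · rw [u1, v1, hi]; exact Or.inl hiC
      by_cases v2 : v = j
      · rw [u1, v2]; exact Or.inl hij'
      · rw [u1, ho v v1 v2, hi]
        exact (hadji v v1 v2 (u1 ▸ huv)).symm
    by_cases u2 : u = j
    · by_cases v2 : v = j
      · rw [u2, v2, hj]; exact Or.inl h.1
      by_cases v1 : v = i
      · rw [u2, v1]; exact Or.inr hij'
      · rw [u2, ho v v1 v2, hj]
        exact (hadjj v (u2 ▸ huv)).symm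
    rw [ho u u1 u2]
    by_cases v1 : v = i
    · rw [v1, hi]; exact hadji u u1 u2 (v1 ▸ huv.symm)
    by_cases v2 : v = j
    · rw [v2, hj]; exact hadjj u (v2 ▸ huv.symm)
    rw [ho v v1 v2]
    exact hD.adj huv
  · intro v
    by_cases h1 : v = i
    · rw [h1, hi]; exact hCc
    by_cases h2 : v = j
    · rw [h2, hj]; exact hD.conn i
    · rw [ho v h1 h2]; exact hD.conn v

end Nested

/-! ### Parent maps versus descendant sets. -/

open Relation

section Tree

variable {G : SimpleGraph (Fin n)} {p : Fin n → Option (Fin n)}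

theorem parent_rightUnique (p : Fin n → Option (Fin n)) :
    Relator.RightUnique (fun u w => p u = some w) := by
  intro a b c hb hc
  rw [hb] at hc
  exact Option.some.inj hc

/-- The properties of an elimination tree on `S` with root `x` inside of `S`. -/
structure TreeProps (G : SimpleGraph (Fin n)) (p : Fin n → Option (Fin n)) (S : Set (Fin n))
    (x : Fin n) : Prop where
  root : ∀ v ∈ S, ReflTransGen (fun u w => p u = some w) v x
  parent : ∀ v ∈ S, v ≠ x → ∃ u ∈ S, p v = some u
  acyclic : ∀ v ∈ S, ¬ TransGen (fun u w => p u = some w) v v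
  adj : ∀ u ∈ S, ∀ v ∈ S, G.Adj u v → u ∈ descendants p v ∨ v ∈ descendants p u
  conn : ∀ v ∈ S, Conn G (descendants p v ∩ S)

theorem TreeProps.ancestor {S : Set (Fin n)} {x u v : Fin n} (h : TreeProps G p S x) (hu : u ∈ S)
    (huv : ReflTransGen (fun u w => p u = some w) u v) :
    v ∈ S ∨ TransGen (fun u w => p u = some w) x v := by
  induction huv with
  | refl => exact Or.inl hu
  | @tail b c _ hbc ih =>
    rcases ih with ih | ih
    · by_cases hbx : b = x
      · exact Or.inr (hbx ▸ TransGen.single hbc)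
      · obtain ⟨w, hw, hbw⟩ := h.parent b ih hbx
        exact Or.inl (parent_rightUnique p hbc hbw ▸ hw)
    · exact Or.inr (ih.tail hbc)

/-- `IsElimTree` says nothing about `p` at the root or outside `S`, so the ancestors of the root
must be kept out of `S` to exclude cycles. The condition passes to subtrees, because above the root
of a subtree there are only `x` and the ancestors of `x`. -/
theorem IsElimTree.props {S : Set (Fin n)} {x : Fin n} (h : IsElimTree G p S x) :
    (∀ y, TransGen (fun u w => p u = some w) x y → y ∉ S) → TreeProps G p S x := by
  induction h with
  | node S x hS hx root parent subtree ih =>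
    intro hroot
    have comp : ∀ v ∈ S, v ≠ x → ∃ C, IsComponent G (S \ {x}) C ∧ v ∈ C :=
      fun v hv hvx => exists_isComponent ⟨hv, hvx⟩
    have sub : ∀ C, IsComponent G (S \ {x}) C → C ⊆ S := fun C hC => hC.1.1.trans Set.sdiff_subset
    have hxC : ∀ C, IsComponent G (S \ {x}) C → x ∉ C := fun C hC hx => (hC.1.1 hx).2 rfl
    have above : ∀ C, IsComponent G (S \ {x}) C → ∀ y,
        TransGen (fun u w => p u = some w) (root C) y →
        y = x ∨ TransGen (fun u w => p u = some w) x y := by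
      intro C hC y hy
      obtain ⟨c, hc, hcy⟩ := TransGen.head'_iff.1 hy
      obtain rfl := parent_rightUnique p hc (parent C hC)
      exact (reflTransGen_iff_eq_or_transGen.1 hcy)
    have props : ∀ C, IsComponent G (S \ {x}) C → TreeProps G p C (root C) := by
      intro C hC
      refine ih C hC fun y hy hyC => ?_
      rcases above C hC y hy with rfl | h
      · exact hxC C hC hyC
      · exact hroot y h (sub C hC hyC)
    have hdesc : ∀ v ∈ S, ReflTransGen (fun u w => p u = some w) v x := by
      intro v hv
      by_cases hvx : v = x
      · rw [hvx]
      · obtain ⟨C, hC, hvC⟩ := comp v hv hvx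
        exact ((props C hC).root v hvC).tail (parent C hC)
    have hxdesc : ∀ v ∈ S, x ∈ descendants p v → v = x := by
      intro v hv h
      rcases reflTransGen_iff_eq_or_transGen.1 h with h | h
      · exact h
      · exact absurd hv (hroot v h)
    refine ⟨hdesc, ?_, ?_, ?_, ?_⟩
    · intro v hv hvx
      obtain ⟨C, hC, hvC⟩ := comp v hv hvx
      by_cases hvr : v = root C
      · exact ⟨x, hx, hvr ▸ parent C hC⟩
      · obtain ⟨u, hu, h⟩ := (props C hC).parent v hvC hvr
        exact ⟨u, sub C hC hu, h⟩
    · intro v hv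
      by_cases hvx : v = x
      · exact fun h => hroot v (hvx ▸ h) hv
      · obtain ⟨C, hC, hvC⟩ := comp v hv hvx
        exact (props C hC).acyclic v hvC
    · intro u hu v hv huv
      by_cases hux : u = x
      · exact Or.inr (hux ▸ hdesc v hv)
      by_cases hvx : v = x
      · exact Or.inl (hvx ▸ hdesc u hu)
      obtain ⟨C, hC, huC⟩ := comp u hu hux
      exact (props C hC).adj u huC v ((isComponent_iff.1 hC).2.2 u huC v ⟨hv, hvx⟩ huv) huv
    · intro v hv
      by_cases hvx : v = x
      · have : descendants p v ∩ S = S := Set.inter_eq_right.2 fun u hu => hvx ▸ hdesc u hu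
        rw [this]
        exact conn_iff.2 hS
      obtain ⟨C, hC, hvC⟩ := comp v hv hvx
      have : descendants p v ∩ S = descendants p v ∩ C := by
        refine Set.Subset.antisymm ?_ (Set.inter_subset_inter_right _ (sub C hC))
        rintro u ⟨huv, hu⟩
        refine ⟨huv, ?_⟩
        have hux : u ≠ x := by
          rintro rfl
          exact hvx (hxdesc v hv huv)
        obtain ⟨E, hE, huE⟩ := comp u hu hux
        rcases (props E hE).ancestor huE huv with h | h
        · exact hC.eq_of_mem hE hvC h ▸ huE
        · rcases above E hE v h with h | h
          · exact absurd h hvx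
          · exact absurd hv (hroot v h)
      rw [this]
      exact (props C hC).conn v hvC

theorem IsElimForest.nested (h : IsElimForest G p) : Nested G (descendants p) := by
  have comp : ∀ v, ∃ C r, v ∈ C ∧ IsComponent G Set.univ C ∧ p r = none ∧ TreeProps G p C r := by
    intro v
    obtain ⟨C, hC, hv⟩ := exists_isComponent (H := G) (Set.mem_univ v)
    obtain ⟨r, hr, ht⟩ := h C hC
    refine ⟨C, r, hv, hC, hr, ht.props fun y hy => ?_⟩
    obtain ⟨c, hc, -⟩ := TransGen.head'_iff.1 hy
    rw [hr] at hc
    cases hc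
  refine ⟨fun v => ReflTransGen.refl, fun h u hu => ReflTransGen.trans hu h, ?_, ?_, ?_, ?_⟩
  · intro u v huv hvu
    obtain ⟨C, r, hu, -, -, hp⟩ := comp u
    rcases reflTransGen_iff_eq_or_transGen.1 huv with h | h
    · exact h.symm
    · exact absurd (h.trans_left hvu) (hp.acyclic u hu)
  · intro u v w hu hv
    exact ReflTransGen.total_of_right_unique (parent_rightUnique p) hu hv
  · intro u v huv
    obtain ⟨C, r, hu, hC, -, hp⟩ := comp u
    exact hp.adj u hu v ((isComponent_iff.1 hC).2.2 u hu v trivial huv) huv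
  · intro v
    obtain ⟨C, r, hv, hC, -, hp⟩ := comp v
    have : descendants p v ∩ C = descendants p v := by
      refine Set.inter_eq_left.2 fun u huv => ?_
      obtain ⟨E, s, hu, hE, hs, hpE⟩ := comp u
      rcases hpE.ancestor hu huv with h | h
      · exact hC.eq_of_mem hE hv h ▸ hu
      · obtain ⟨c, hc, -⟩ := TransGen.head'_iff.1 h
        rw [hs] at hc
        cases hc
    exact this ▸ hp.conn v hv

theorem IsElimForest.parent_ne (h : IsElimForest G p) (v : Fin n) : p v ≠ some v := by
  obtain ⟨C, hC, hv⟩ := exists_isComponent (H := G) (Set.mem_univ v)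
  obtain ⟨r, hr, ht⟩ := h C hC
  have hp := ht.props (fun y hy => by
    obtain ⟨c, hc, -⟩ := TransGen.head'_iff.1 hy
    rw [hr] at hc
    cases hc)
  exact fun h => hp.acyclic v hv (TransGen.single h)

theorem IsElimForest.parent_iff (h : IsElimForest G p) {u v : Fin n} :
    p v = some u ↔ Cov (descendants p) u v := by
  have key : ∀ u, p v = some u → Cov (descendants p) u v := by
    intro u hu
    refine ⟨ReflTransGen.single hu, ?_, ?_⟩
    · rintro rfl
      exact h.parent_ne _ hu
    · intro w hw hwv
      rcases ReflTransGen.cases_head hw with h | ⟨c, hc, hcw⟩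
      · exact absurd h.symm hwv
      · exact parent_rightUnique p hc hu ▸ hcw
  refine ⟨key u, fun hc => ?_⟩
  rcases ReflTransGen.cases_head hc.1 with h' | ⟨c, hcv, -⟩
  · exact absurd h' hc.2.1
  · rw [h.nested.cov_unique hc (key c hcv)]
    exact hcv

end Tree

/-- The descendant sets of an elimination forest. -/
def ElimForest.desc {G : SimpleGraph (Fin n)} (F : ElimForest G) : Fin n → Set (Fin n) :=
  descendants F.1

namespace ElimForest

variable {G : SimpleGraph (Fin n)}

theorem nested (F : ElimForest G) : Nested G F.desc := IsElimForest.nested F.2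

theorem parent_iff (F : ElimForest G) {u v : Fin n} : F.1 v = some u ↔ Cov F.desc u v :=
  IsElimForest.parent_iff F.2

theorem desc_injective : Function.Injective (desc : ElimForest G → Fin n → Set (Fin n)) := by
  intro F F' h
  refine Subtype.ext (funext fun v => Option.ext fun u => ?_)
  change F.1 v = some u ↔ F'.1 v = some u
  rw [F.parent_iff, F'.parent_iff, h]

end ElimForest

/-- Take the covering vertex as parent. The top vertices of `D x \ {x}` are the children of `x`, and
their sets are its components, which is the recursion for elimination trees. -/
theorem Nested.exists_elimForest {G : SimpleGraph (Fin n)} {D : Fin n → Set (Fin n)}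
    (hD : Nested G D) : ∃ F : ElimForest G, F.desc = D := by
  classical
  obtain ⟨p, hp⟩ : ∃ p : Fin n → Option (Fin n), ∀ u v, p v = some u ↔ Cov D u v := by
    refine ⟨fun v => if h : ∃ i, Cov D i v then some h.choose else none, fun u v => ?_⟩
    by_cases h : ∃ i, Cov D i v
    · simp only [h, dite_true, Option.some.injEq]
      exact ⟨fun hu => hu ▸ h.choose_spec, fun hu => hD.cov_unique h.choose_spec hu⟩
    · simp only [h, dite_false, reduceCtorEq, false_iff]
      exact fun hu => h ⟨u, hu⟩
  have hdesc : descendants p = D := by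
    funext u
    ext v
    constructor
    · rintro (h : ReflTransGen (fun u w => p u = some w) v u)
      induction h with
      | refl => exact hD.self _
      | tail _ hbc ih => exact hD.trans ((hp _ _).1 hbc).1 ih
    · intro h
      suffices ∀ A, ∀ v, D v = A → v ∈ D u → ReflTransGen (fun u w => p u = some w) v u from
        this _ v rfl h
      -- The path from `v` to `u` is built by climbing, so the induction is on growing descendant
      -- sets.
      intro A
      induction A using (wellFounded_gt (α := Set (Fin n))).induction with
      | _ A ih =>
        intro v hvA hv
        by_cases huv : u = v
        · rw [huv]
        obtain ⟨i, hi⟩ := hD.exists_cov hv huv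
        refine ReflTransGen.head ((hp i v).2 hi) (ih (D i) ?_ i rfl (hi.2.2 u hv huv))
        rw [← hvA]
        exact (hD.trans hi.1).ssubset_of_ne fun h => hi.2.1 (hD.inj h)
  have key : ∀ A, ∀ x, D x = A → IsElimTree G p (D x) x := by
    intro A
    induction A using (wellFounded_lt (α := Set (Fin n))).induction with
    | _ A ih =>
      intro x hx
      have hroot : ∀ C, ∃ c, IsComponent G (D x \ {x}) C → Cov D x c ∧ C = D c := by
        intro C
        by_cases hC : IsComponent G (D x \ {x}) C
        · obtain ⟨c, hc, htop, rfl⟩ := hD.eq_of_isComponent (hD.diff_closed x) hC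
          obtain ⟨i, hi⟩ := hD.exists_cov hc.1 (Ne.symm hc.2)
          have : i = x := by
            by_contra hix
            exact hi.2.1 (htop i ⟨hi.2.2 x hc.1 (Ne.symm hc.2), hix⟩ hi.1).symm
          exact ⟨c, fun _ => ⟨this ▸ hi, rfl⟩⟩
        · exact ⟨x, fun h => absurd h hC⟩
      choose root h using hroot
      refine IsElimTree.node _ _ (conn_iff.1 (hD.conn x)) (hD.self x) root
        (fun C hC => (hp _ _).2 (h C hC).1) fun C hC => ?_
      have h2 := (h C hC).2
      have h1 := (h C hC).1
      have h3 := ih (D (root C)) (hx ▸ (hD.trans h1.1).ssubset_of_ne fun h => h1.2.1 (hD.inj h))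
        (root C) rfl
      rwa [← h2] at h3
  refine ⟨⟨p, fun C hC => ?_⟩, hdesc⟩
  obtain ⟨c, -, htop, rfl⟩ := hD.eq_of_isComponent (fun _ _ => Set.subset_univ _) hC
  refine ⟨c, ?_, key _ c rfl⟩
  rw [Option.eq_none_iff_forall_not_mem]
  intro i hi
  have hi := (hp _ _).1 hi
  exact hi.2.1 (htop i trivial hi.1).symm

/-- Only children of `j` can be reattached. A child subtree of `i` contains a neighbor of `i`, which
keeps it below `i` after the rotation; the case `u ≠ i` only compares the two families. -/
theorem Nested.cov_of_rot_of_cov {H : SimpleGraph (Fin n)} {D D' : Fin n → Set (Fin n)}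
    (hD : Nested H D) (hD' : Nested H D') {i j u v : Fin n} (h : Rot D D' i j) (hvi : v ≠ i)
    (hvj : v ≠ j) (hc : Cov D u v) (huj : u ≠ j) : Cov D' u v := by
  obtain ⟨hij, hj, ho⟩ := h
  have hcov := hD.cov_of_rot hD' ⟨hij, hj, ho⟩
  have hcov' := hD'.cov_of_rot hD (Rot.symm ⟨hij, hj, ho⟩)
  have hsub : D' i ⊆ D i := by
    rw [← hj]
    exact hD'.trans hcov'.1
  by_cases hui : u = i
  · subst hui
    have hv : v ∈ D' u := by
      obtain ⟨w, hw, huw⟩ := hD.cov_adj hc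
      rw [← ho v hvi hvj] at hw
      have h1 : u ∉ D' v := by
        rw [ho v hvi hvj]
        exact fun hu => hvi (hD.antisymm hc.1 hu)
      rcases hD'.adj huw with h | h
      · exact absurd (hD'.trans hw h) h1
      · rcases hD'.laminar hw h with h | h
        · exact h
        · exact absurd h h1
    refine ⟨hv, hvi, fun w hw hwv => ?_⟩
    by_cases hwu : w = u
    · rw [hwu]; exact hD'.self u
    by_cases hwj : w = j
    · rw [hwj]; exact hcov'.1
    rw [ho w hwu hwj] at hw ⊢
    exact hc.2.2 w hw hwv
  · have hv : v ∈ D' u := by rw [ho u hui huj]; exact hc.1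
    refine ⟨hv, hc.2.1, fun w hw hwv => ?_⟩
    by_cases hwi : w = i
    · subst hwi
      have hu := hc.2.2 w (hsub hw) hwv
      rcases hD'.laminar hv hw with h | h
      · exact h
      · rw [ho u hui huj] at h
        exact absurd (hD.antisymm hu h) hui
    by_cases hwj : w = j
    · rw [hwj, hj] at hw ⊢
      exact hc.2.2 i hw hvi.symm
    rw [ho w hwi hwj] at hw ⊢
    exact hc.2.2 w hw hwv

/-- The parent map `rotate` and the relation `Rot` agree vertex by vertex: the component in `rotate`
is the new set of `i`, so a child `v` of `j` moves exactly when its subtree is contained in that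
set. -/
theorem rotate_eq {G : SimpleGraph (Fin n)} {F F' : ElimForest G} {i j : Fin n}
    (h : Rot F.desc F'.desc i j) : rotate G F.1 i j = F'.1 := by
  classical
  have hD := F.nested
  have hD' := F'.nested
  obtain ⟨hij, hj, ho⟩ := h
  have hrot : Rot F.desc F'.desc i j := ⟨hij, hj, ho⟩
  have hcov := hD.cov_of_rot hD' hrot
  have hcov' := hD'.cov_of_rot hD hrot.symm
  have hcomp := hD'.isComponent_of_cov hcov'
  rw [hj] at hcomp
  have hC : ∀ v, (∃ C, IsComponent G (descendants F.1 i \ {j}) C ∧ i ∈ C ∧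
      descendants F.1 v ⊆ C) ↔ F.desc v ⊆ F'.desc i := by
    intro v
    constructor
    · rintro ⟨C, hC, hi, hv⟩
      rw [hcomp.eq_of_mem hC (hD'.self i) hi]
      exact hv
    · exact fun hv => ⟨_, hcomp, hD'.self i, hv⟩
  refine funext fun v => Option.ext fun u => ?_
  unfold rotate
  by_cases hvj : v = j
  · subst hvj
    rw [if_pos rfl, F.parent_iff, F'.parent_iff]
    -- `j` takes the place of `i` under the old parent; stated for arbitrary families so that the
    -- reverse rotation gives the converse.
    have key : ∀ {D D' : Fin n → Set (Fin n)}, Nested G D → Nested G D' → ∀ {i j : Fin n},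
        Rot D D' i j → Cov D u i → Cov D' u j := by
      intro D D' hD hD' i j hr hc
      have hij := hr.1
      have hui : u ≠ i := hc.2.1.symm
      have huj : u ≠ j := by
        rintro rfl
        exact hui (hD.antisymm (hD.cov_of_rot hD' hr).1 hc.1)
      have hju : j ∈ D' u := by
        rw [hr.2.2 u hui huj]
        exact hD.trans hc.1 (hD.cov_of_rot hD' hr).1
      refine ⟨hju, huj.symm, fun w hw hwj => ?_⟩
      by_cases hwi : w = i
      · subst hwi
        exact absurd (hD'.antisymm hw (hD'.cov_of_rot hD hr.symm).1).symm hij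
      · have := hD'.trans hw
        rw [hr.2.1, hr.2.2 w hwi hwj] at this
        rw [hr.2.2 w hwi hwj]
        exact hc.2.2 w (this (hD.self i)) hwi
    exact ⟨key hD hD' hrot, key hD' hD hrot.symm⟩
  rw [if_neg hvj]
  by_cases hvi : v = i
  · subst hvi
    rw [if_pos rfl, F'.parent_iff]
    constructor
    · rintro ⟨⟩
      exact hcov'
    · exact fun h => congrArg some (hD'.cov_unique hcov' h)
  rw [if_neg hvi]
  by_cases hc : Cov F.desc j v
  · have hpv := F.parent_iff.2 hc
    by_cases hsub : F.desc v ⊆ F'.desc i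
    · have hv : Cov F'.desc i v := by
        refine ⟨hsub (hD.self v), hvi, fun w hw hwv => ?_⟩
        by_cases hwi : w = i
        · rw [hwi]; exact hD'.self i
        by_cases hwj : w = j
        · rw [hwj]; exact hcov'.1
        rw [ho w hwi hwj] at hw ⊢
        exact hcov.2.2 w (hc.2.2 w hw hwv) hwj
      rw [if_pos ⟨hpv, (hC v).2 hsub⟩, F'.parent_iff]
      constructor
      · rintro ⟨⟩
        exact hv
      · exact fun h => congrArg some (hD'.cov_unique hv h)
    · have hv : Cov F'.desc j v := by
        refine ⟨?_, hvj, fun w hw hwv => ?_⟩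
        · rw [hj]
          exact hD.trans hcov.1 hc.1
        by_cases hwi : w = i
        · subst hwi
          refine absurd ?_ hsub
          rw [← ho v hvi hvj]
          exact hD'.trans hw
        by_cases hwj : w = j
        · rw [hwj]; exact hD'.self j
        have := ho w hwi hwj
        rw [this] at hw ⊢
        exact hc.2.2 w hw hwv
      rw [if_neg (fun h => hsub ((hC v).1 h.2)), hpv, F'.parent_iff]
      constructor
      · rintro ⟨⟩
        exact hv
      · exact fun h => congrArg some (hD'.cov_unique hv h)
  · rw [if_neg (fun h => hc (F.parent_iff.1 h.1)), F.parent_iff, F'.parent_iff]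
    constructor
    · intro h
      refine hD.cov_of_rot_of_cov hD' hrot hvi hvj h ?_
      rintro rfl
      exact hc h
    · intro h
      -- A child of `i` after the rotation was a child of `i` or of `j` before; the latter
      -- contradicts `hc`.
      by_cases hui : u = i
      · subst hui
        by_cases hvF : v ∈ F.desc j
        · exfalso
          refine hc ?_
          refine ⟨hvF, hvj, fun w hw hwv => ?_⟩
          by_cases hwi : w = u
          · rw [hwi]; exact hcov.1
          by_cases hwj : w = j
          · rw [hwj]; exact hD.self j
          rw [← ho w hwi hwj] at hw ⊢
          have := h.2.2 w hw hwv
          rw [ho w hwi hwj] at this ⊢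
          exact hD.trans this hcov.1
        · have hvi' : v ∈ F.desc u := by
            rw [← hj]
            exact hD'.trans hcov'.1 h.1
          refine ⟨hvi', hvi, fun w hw hwv => ?_⟩
          by_cases hwi : w = u
          · rw [hwi]; exact hD.self u
          by_cases hwj : w = j
          · exact absurd (hwj ▸ hw) hvF
          rw [← ho w hwi hwj] at hw ⊢
          exact h.2.2 w hw hwv
      · exact hD'.cov_of_rot_of_cov hD hrot.symm hvj hvi h hui

theorem isRotation_iff {G : SimpleGraph (Fin n)} {F F' : ElimForest G} {i j : Fin n} :
    IsRotation F F' i j ↔ Rot F.desc F'.desc i j ∨ Rot F.desc F'.desc j i := by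
  have key : ∀ i j, (F.1 j = some i ∧ F'.1 = rotate G F.1 i j) ↔ Rot F.desc F'.desc i j := by
    intro i j
    constructor
    · rintro ⟨h, h'⟩
      obtain ⟨D', hD', hrot⟩ := F.nested.exists_rot (F.parent_iff.1 h)
      obtain ⟨E, rfl⟩ := hD'.exists_elimForest
      have : F' = E := Subtype.ext (h'.trans (rotate_eq hrot))
      exact this ▸ hrot
    · intro h
      exact ⟨F.parent_iff.2 (F.nested.cov_of_rot F'.nested h), (rotate_eq h).symm⟩
  exact or_congr (key i j) (key j i)

/-! ### Inserting and deleting a simplicial vertex. -/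

/-- `H'` arises from `H`, in which the vertices from `m` on are isolated, by joining `m` to all
vertices of the nonempty clique `N`. -/
structure Extends (H H' : SimpleGraph (Fin n)) (m : Fin n) (N : Set (Fin n)) : Prop where
  isolated : ∀ v, m ≤ v → ∀ u, ¬ H.Adj v u
  adj_iff : ∀ u v, H'.Adj u v ↔ H.Adj u v ∨ (u = m ∧ v ∈ N) ∨ (v = m ∧ u ∈ N)
  lt : ∀ v ∈ N, v < m
  clique : ∀ u ∈ N, ∀ v ∈ N, u ≠ v → H.Adj u v
  nonempty : N.Nonempty

/-- The possible sets of vertices below `m` when it is inserted into the forest `D`. -/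
def positions (N : Set (Fin n)) (D : Fin n → Set (Fin n)) : Set (Set (Fin n)) :=
  {T | T = ∅ ∨ ∃ c, T = D c ∧ (D c ∩ N).Nonempty}

open Classical in
/-- The forest obtained from `D` by inserting `m` directly above the vertices in `T`. -/
noncomputable def ins (N : Set (Fin n)) (m : Fin n) (D : Fin n → Set (Fin n)) (T : Set (Fin n)) :
    Fin n → Set (Fin n) := fun v =>
  if v = m then insert m T
  else if T ⊂ D v ∧ (D v ∩ N).Nonempty then insert m (D v) else D v

open Classical in
/-- The forest obtained from `D` by isolating `m`. -/
noncomputable def del (m : Fin n) (D : Fin n → Set (Fin n)) : Fin n → Set (Fin n) := fun v =>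
  if v = m then {m} else D v \ {m}

theorem Nested.eq_singleton {H : SimpleGraph (Fin n)} {D : Fin n → Set (Fin n)} (hD : Nested H D)
    {v : Fin n} (hv : ∀ u, ¬ H.Adj v u) : D v = {v} := by
  refine Set.Subset.antisymm (fun u hu => ?_) (by simpa using hD.self v)
  by_contra huv
  obtain ⟨b, -, hb⟩ := (hD.conn v).exists_adj (hD.self v) hu huv
  exact hv b hb

theorem Nested.notMem_of_isolated {H : SimpleGraph (Fin n)} {D : Fin n → Set (Fin n)}
    (hD : Nested H D) {v u : Fin n} (hv : ∀ u, ¬ H.Adj v u) (huv : u ≠ v) : v ∉ D u := by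
  intro h
  obtain ⟨b, -, hb⟩ := (hD.conn u).exists_adj h (hD.self u) huv
  exact hv b hb

/-- The vertices of a clique lie on one path from a root, so two subtrees meeting the clique cannot
branch apart. -/
theorem Nested.comparable {H : SimpleGraph (Fin n)} {D : Fin n → Set (Fin n)} (hD : Nested H D)
    {N : Set (Fin n)} (hN : ∀ u ∈ N, ∀ v ∈ N, u ≠ v → H.Adj u v) {c v : Fin n}
    (hc : (D c ∩ N).Nonempty) (hv : (D v ∩ N).Nonempty) : c ∈ D v ∨ v ∈ D c := by
  obtain ⟨y, hy, hyN⟩ := hc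
  obtain ⟨z, hz, hzN⟩ := hv
  by_cases hyz : y = z
  · exact hD.laminar hy (hyz ▸ hz)
  · rcases hD.adj (hN y hyN z hzN hyz) with h | h
    · exact hD.laminar hy (hD.trans hz h)
    · exact hD.laminar (hD.trans hy h) hz

section

variable {H H' : SimpleGraph (Fin n)} {m : Fin n} {N : Set (Fin n)}
  {D : Fin n → Set (Fin n)} {T : Set (Fin n)}

theorem mem_ins_self {u : Fin n} : u ∈ ins N m D T m ↔ u = m ∨ u ∈ T := by
  simp [ins]

theorem mem_ins {u v : Fin n} (hv : v ≠ m) (hu : u ≠ m) : u ∈ ins N m D T v ↔ u ∈ D v := by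
  unfold ins
  rw [if_neg hv]
  split_ifs <;> simp [hu]

theorem self_mem_ins {v : Fin n} (hv : v ≠ m) (hmv : m ∉ D v) :
    m ∈ ins N m D T v ↔ T ⊂ D v ∧ (D v ∩ N).Nonempty := by
  unfold ins
  rw [if_neg hv]
  split_ifs with h <;> simp [h, hmv]

theorem mem_del {u v : Fin n} (hv : v ≠ m) : u ∈ del m D v ↔ u ∈ D v ∧ u ≠ m := by
  simp [del, hv]

theorem del_self : del m D m = {m} := by
  simp [del]

variable (E : Extends H H' m N)
include E

theorem Extends.le : H ≤ H' := fun u v h => (E.adj_iff u v).2 (Or.inl h)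

theorem Extends.notMem_self : m ∉ N := fun h => lt_irrefl _ (E.lt m h)

theorem Extends.adj_self {v : Fin n} : H'.Adj m v ↔ v ∈ N := by
  rw [E.adj_iff]
  constructor
  · rintro (h | ⟨-, h⟩ | ⟨-, h⟩)
    · exact absurd h (E.isolated m le_rfl v)
    · exact h
    · exact absurd h E.notMem_self
  · exact fun h => Or.inr (Or.inl ⟨rfl, h⟩)

theorem Extends.adj_of_ne {u v : Fin n} (hu : u ≠ m) (hv : v ≠ m) : H'.Adj u v ↔ H.Adj u v := by
  rw [E.adj_iff]
  simp [hu, hv]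

theorem Extends.isolated_of_lt {v : Fin n} (hv : m < v) (u : Fin n) : ¬ H'.Adj v u := by
  rw [E.adj_iff]
  rintro (h | ⟨h, -⟩ | ⟨-, h⟩)
  · exact E.isolated v hv.le u h
  · exact hv.ne' h
  · exact hv.not_gt (E.lt v h)

theorem Extends.notMem (hD : Nested H D) {v : Fin n} (hv : v ≠ m) : m ∉ D v :=
  hD.notMem_of_isolated (E.isolated m le_rfl) hv

theorem Extends.ne_of_meets (hD : Nested H D) {c : Fin n} (hc : (D c ∩ N).Nonempty) : c ≠ m := by
  rintro rfl
  obtain ⟨y, hy, hyN⟩ := hc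
  rw [hD.eq_singleton (E.isolated c le_rfl), Set.mem_singleton_iff] at hy
  exact E.notMem_self (hy ▸ hyN)

theorem Extends.notMem_position (hD : Nested H D) (hT : T ∈ positions N D) : m ∉ T := by
  rcases hT with rfl | ⟨c, rfl, hc⟩
  · simp
  · exact E.notMem hD (E.ne_of_meets hD hc)

/-- Every subtree that meets `N` is rooted in `T` or properly contains `T` (`hcmp`), so the
neighbors of `m` become its ancestors or descendants. Sets enlarged by `m` stay connected because
they contain a neighbor of `m`. -/
theorem Extends.nested_ins (hD : Nested H D) (hT : T ∈ positions N D) :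
    Nested H' (ins N m D T) := by
  have hm : ∀ {v}, v ≠ m → m ∉ D v := fun hv => E.notMem hD hv
  have hmT := E.notMem_position hD hT
  have hdown : ∀ {u}, u ∈ T → D u ⊆ T := by
    intro u hu
    rcases hT with rfl | ⟨c, rfl, hc⟩
    · exact absurd hu (by simp)
    · exact hD.trans hu
  have hcmp : ∀ {v}, (D v ∩ N).Nonempty → v ∈ T ∨ T ⊂ D v := by
    intro v hv
    rcases hT with rfl | ⟨c, rfl, hc⟩
    · exact Or.inr (Set.empty_ssubset.2 ⟨v, hD.self v⟩)
    · by_cases hvc : v ∈ D c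
      · exact Or.inl hvc
      · have := (hD.comparable E.clique hc hv).resolve_right hvc
        exact Or.inr ((hD.trans this).ssubset_of_ne fun h => hvc (h ▸ hD.self v))
  have hcmp' : ∀ {v w}, w ∈ T → w ∈ D v → v ∈ T ∨ T ⊂ D v ∧ (D v ∩ N).Nonempty := by
    intro v w hw hv
    rcases hT with rfl | ⟨c, rfl, hc⟩
    · exact absurd hw (by simp)
    · rcases hD.laminar hw hv with h | h
      · have hmeet : (D v ∩ N).Nonempty := hc.mono (Set.inter_subset_inter_left _ (hD.trans h))
        by_cases hvc : v ∈ D c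
        · exact Or.inl hvc
        · exact Or.inr ⟨(hD.trans h).ssubset_of_ne fun h => hvc (h ▸ hD.self v), hmeet⟩
      · exact Or.inl h
  refine ⟨?_, ?_, ?_, ?_, ?_, ?_⟩
  · intro v
    by_cases hv : v = m
    · rw [hv, mem_ins_self]; exact Or.inl rfl
    · exact (mem_ins hv hv).2 (hD.self v)
  · intro u v huv w hw
    by_cases hu : u = m
    · rw [hu] at huv hw
      by_cases hv : v = m
      · rwa [hv]
      · by_cases hwm : w = m
        · rwa [hwm]
        · rw [self_mem_ins hv (hm hv)] at huv
          rw [mem_ins_self] at hw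
          exact (mem_ins hv hwm).2 (huv.1.1 (hw.resolve_left hwm))
    by_cases hv : v = m
    · rw [hv] at huv ⊢
      have huT := (mem_ins_self.1 huv).resolve_left hu
      by_cases hwm : w = m
      · exact mem_ins_self.2 (Or.inl hwm)
      · exact mem_ins_self.2 (Or.inr (hdown huT ((mem_ins hu hwm).1 hw)))
    rw [mem_ins hv hu] at huv
    by_cases hwm : w = m
    · rw [hwm] at hw ⊢
      rw [self_mem_ins hu (hm hu)] at hw
      rw [self_mem_ins hv (hm hv)]
      exact ⟨hw.1.trans_subset (hD.trans huv),
        hw.2.mono (Set.inter_subset_inter_left _ (hD.trans huv))⟩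
    · rw [mem_ins hu hwm] at hw
      exact (mem_ins hv hwm).2 (hD.trans huv hw)
  · have key : ∀ {v}, v ≠ m → m ∈ ins N m D T v → v ∈ ins N m D T m → False := by
      intro v hv h1 h2
      have h1 := (self_mem_ins hv (hm hv)).1 h1
      have h2 := (mem_ins_self.1 h2).resolve_left hv
      exact h1.1.2 (hdown h2)
    intro u v huv hvu
    by_cases hu : u = m
    · by_cases hv : v = m
      · rw [hu, hv]
      · rw [hu] at huv hvu; exact (key hv huv hvu).elim
    by_cases hv : v = m
    · rw [hv] at huv hvu; exact (key hu hvu huv).elim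
    exact hD.antisymm ((mem_ins hv hu).1 huv) ((mem_ins hu hv).1 hvu)
  · have key : ∀ {v w}, v ≠ m → w ∈ ins N m D T m → w ∈ ins N m D T v →
        m ∈ ins N m D T v ∨ v ∈ ins N m D T m := by
      intro v w hv hw hwv
      by_cases hwm : w = m
      · exact Or.inl (hwm ▸ hwv)
      · have hw := (mem_ins_self.1 hw).resolve_left hwm
        rcases hcmp' hw ((mem_ins hv hwm).1 hwv) with h | h
        · exact Or.inr (mem_ins_self.2 (Or.inr h))
        · exact Or.inl ((self_mem_ins hv (hm hv)).2 h)
    intro u v w hwu hwv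
    by_cases hu : u = m
    · by_cases hv : v = m
      · rw [hu, hv]; exact Or.inl (mem_ins_self.2 (Or.inl rfl))
      · rw [hu] at hwu ⊢; exact key hv hwu hwv
    by_cases hv : v = m
    · rw [hv] at hwv ⊢; exact (key hu hwv hwu).symm
    rw [mem_ins hv hu, mem_ins hu hv]
    by_cases hwm : w = m
    · rw [hwm, self_mem_ins hu (hm hu)] at hwu
      rw [hwm, self_mem_ins hv (hm hv)] at hwv
      exact hD.comparable E.clique hwu.2 hwv.2
    · exact hD.laminar ((mem_ins hu hwm).1 hwu) ((mem_ins hv hwm).1 hwv)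
  · have key : ∀ {v}, v ≠ m → H'.Adj m v → m ∈ ins N m D T v ∨ v ∈ ins N m D T m := by
      intro v hv h
      have hmeet : (D v ∩ N).Nonempty := ⟨v, hD.self v, E.adj_self.1 h⟩
      rcases hcmp hmeet with h' | h'
      · exact Or.inr (mem_ins_self.2 (Or.inr h'))
      · exact Or.inl ((self_mem_ins hv (hm hv)).2 ⟨h', hmeet⟩)
    intro u v huv
    by_cases hu : u = m
    · have hv : v ≠ m := fun hv => huv.ne (hu.trans hv.symm)
      rw [hu] at huv ⊢; exact key hv huv
    by_cases hv : v = m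
    · rw [hv] at huv ⊢; exact (key hu huv.symm).symm
    rw [mem_ins hv hu, mem_ins hu hv]
    exact hD.adj ((E.adj_of_ne hu hv).1 huv)
  · have hle : ∀ v, Conn H' (D v) := fun v => (hD.conn v).of_adj fun a _ b _ h => E.le h
    have hins : ∀ v, (D v ∩ N).Nonempty → Conn H' (insert m (D v)) := by
      rintro v ⟨y, hy, hyN⟩
      exact (hle v).insert hy (E.adj_self.2 hyN).symm
    intro v
    unfold ins
    split_ifs with h1 h2
    · rcases hT with rfl | ⟨c, rfl, hc⟩
      · simpa using conn_singleton m
      · exact hins c hc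
    · exact hins v h2.2
    · exact hle v

theorem Extends.del_ins (hD : Nested H D) : del m (ins N m D T) = D := by
  funext v
  by_cases hv : v = m
  · rw [hv, del_self, hD.eq_singleton (E.isolated m le_rfl)]
  · ext u
    rw [mem_del hv]
    constructor
    · rintro ⟨h, hu⟩
      exact (mem_ins hv hu).1 h
    · intro h
      have hu : u ≠ m := fun hu => E.notMem hD hv (hu ▸ h)
      exact ⟨(mem_ins hv hu).2 h, hu⟩

theorem Extends.conn_diff {S : Set (Fin n)} (hS : Conn H' S) (hne : (S \ {m}).Nonempty) :
    Conn H (S \ {m}) := by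
  refine (hS.diff_singleton hne ?_).of_adj fun a ha b hb h => (E.adj_of_ne ha.2 hb.2).1 h
  intro a _ b _ hma hmb hab
  exact E.le (E.clique a (E.adj_self.1 hma) b (E.adj_self.1 hmb) hab)

theorem Extends.nested_del (hD : Nested H' D) : Nested H (del m D) := by
  have hmm : ∀ {v}, v ≠ m → m ∉ del m D v := fun hv h => ((mem_del hv).1 h).2 rfl
  have hms : ∀ {u}, u ∈ del m D m → u = m := fun h => by simpa [del_self] using h
  refine ⟨?_, ?_, ?_, ?_, ?_, ?_⟩
  · intro v
    by_cases hv : v = m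
    · rw [hv, del_self]; rfl
    · exact (mem_del hv).2 ⟨hD.self v, hv⟩
  · intro u v huv w hw
    by_cases hv : v = m
    · rw [hv] at huv
      rw [hms huv] at hw
      rwa [hv]
    · have hu := (mem_del hv).1 huv
      rw [mem_del hu.2] at hw
      exact (mem_del hv).2 ⟨hD.trans hu.1 hw.1, hw.2⟩
  · intro u v huv hvu
    by_cases hv : v = m
    · rw [hv] at huv ⊢; exact hms huv
    by_cases hu : u = m
    · rw [hu] at hvu ⊢; exact (hms hvu).symm
    exact hD.antisymm ((mem_del hv).1 huv).1 ((mem_del hu).1 hvu).1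
  · intro u v w hwu hwv
    by_cases hu : u = m
    · rw [hu] at hwu
      rw [hms hwu] at hwv
      exact Or.inl (hu ▸ hwv)
    by_cases hv : v = m
    · rw [hv] at hwv
      rw [hms hwv] at hwu
      exact Or.inr (hv ▸ hwu)
    rw [mem_del hu] at *
    rw [mem_del hv] at *
    exact (hD.laminar hwu.1 hwv.1).imp (fun h => ⟨h, hu⟩) fun h => ⟨h, hv⟩
  · intro u v huv
    have hu : u ≠ m := fun hu => E.isolated m le_rfl v (hu ▸ huv)
    have hv : v ≠ m := fun hv => E.isolated m le_rfl u (hv ▸ huv).symm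
    rw [mem_del hu, mem_del hv]
    exact (hD.adj (E.le huv)).imp (fun h => ⟨h, hu⟩) fun h => ⟨h, hv⟩
  · intro v
    by_cases hv : v = m
    · rw [hv, del_self]; exact conn_singleton m
    · have : del m D v = D v \ {m} := by simp [del, hv]
      rw [this]
      exact E.conn_diff (hD.conn v) ⟨v, hD.self v, hv⟩

/-- `D m \ {m}` remains connected since `m` is simplicial, so `m` has a single child. This is why a
down-move of `m` is unique. -/
theorem Extends.exists_child (hD : Nested H' D) (hne : (D m \ {m}).Nonempty) :
    ∃ c, Cov D m c ∧ D m \ {m} = D c := by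
  have hcomp : IsComponent H' (D m \ {m}) (D m \ {m}) := by
    refine isComponent_iff.2 ⟨subset_rfl, ?_, fun a _ b hb _ => hb⟩
    exact (E.conn_diff (hD.conn m) hne).of_adj fun a _ b _ h => E.le h
  obtain ⟨c, hc, htop, heq⟩ := hD.eq_of_isComponent (hD.diff_closed m) hcomp
  obtain ⟨i, hi⟩ := hD.exists_cov hc.1 (Ne.symm hc.2)
  have : i = m := by
    by_contra him
    exact hi.2.1 (htop i ⟨hi.2.2 m hc.1 (Ne.symm hc.2), him⟩ hi.1).symm
  exact ⟨c, this ▸ hi, heq⟩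

theorem Extends.cov_self (hD : Nested H' D) {i : Fin n} (h : Cov D m i) : D m \ {m} = D i := by
  obtain ⟨c, hc, heq⟩ := E.exists_child hD ⟨i, h.1, h.2.1⟩
  have hic : i ∈ D c := heq ▸ (⟨h.1, h.2.1⟩ : i ∈ D m \ {m})
  have : c = i := by
    by_contra hci
    exact hc.2.1 (hD.antisymm hc.1 (h.2.2 c hic hci))
  rw [heq, this]

theorem Extends.diff_mem_positions (hD : Nested H' D) : D m \ {m} ∈ positions N (del m D) := by
  by_cases hne : (D m \ {m}).Nonempty
  · obtain ⟨c, hc, heq⟩ := E.exists_child hD hne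
    have hmc : m ∉ D c := heq ▸ fun h => h.2 rfl
    have hdel : del m D c = D c := by simp [del, hc.2.1, hmc]
    obtain ⟨w, hw, hmw⟩ := hD.cov_adj hc
    exact Or.inr ⟨c, heq.trans hdel.symm, w, hdel.symm ▸ hw, E.adj_self.1 hmw⟩
  · exact Or.inl (Set.not_nonempty_iff_eq_empty.1 hne)

/-- The ancestors of `m` are recognized after the deletion: they meet `N`, by connectivity through
`m`, and properly contain the set below `m`. -/
theorem Extends.ins_del (hD : Nested H' D) : ins N m (del m D) (D m \ {m}) = D := by
  funext v
  ext w
  by_cases hv : v = m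
  · subst hv
    rw [mem_ins_self]
    by_cases hwv : w = v
    · simp [hwv, hD.self v]
    · simp [hwv]
  by_cases hw : w = m
  · subst hw
    have hnot : w ∉ del w D v := fun h => ((mem_del hv).1 h).2 rfl
    rw [self_mem_ins hv hnot]
    constructor
    · rintro ⟨hss, y, hy, hyN⟩
      have hy' := (mem_del hv).1 hy
      rcases hD.adj (E.adj_self.2 hyN) with h | h
      · exact hD.trans hy'.1 h
      · rcases hD.laminar h hy'.1 with h | h
        · exact h
        · refine absurd ?_ hss.2
          intro x hx
          have := (mem_del hv).1 hx
          exact ⟨hD.trans h this.1, this.2⟩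
    · intro h
      constructor
      · constructor
        · rintro x ⟨hx, hxw⟩
          exact (mem_del hv).2 ⟨hD.trans h hx, hxw⟩
        · intro hs
          exact hv (hD.antisymm (hs ((mem_del hv).2 ⟨hD.self v, hv⟩)).1 h)
      · obtain ⟨b, hb, hwb⟩ := (hD.conn v).exists_adj h (hD.self v) hv
        exact ⟨b, (mem_del hv).2 ⟨hb, hwb.ne'⟩, E.adj_self.1 hwb⟩
  · rw [mem_ins hv hw, mem_del hv]
    simp [hw]

/-- If `D c` is the next position above `T`, moving `m` from `T` to `D c` only exchanges `m` with
its parent `c`; `hnext` ensures that all other ancestors of `m` remain ancestors. -/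
theorem Extends.rot_ins_ins (hD : Nested H D) {c : Fin n} (hc : (D c ∩ N).Nonempty)
    (hTc : T ⊂ D c) (hnext : ∀ w, (D w ∩ N).Nonempty → T ⊂ D w → D c ⊆ D w) :
    Rot (ins N m D T) (ins N m D (D c)) c m := by
  have hcm := E.ne_of_meets hD hc
  refine ⟨hcm, ?_, fun w hwc hwm => ?_⟩
  · simp [ins, hcm, hTc, hc]
  · have : (T ⊂ D w ∧ (D w ∩ N).Nonempty) ↔ (D c ⊂ D w ∧ (D w ∩ N).Nonempty) := by
      constructor
      · rintro ⟨h1, h2⟩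
        exact ⟨(hnext w h2 h1).ssubset_of_ne fun h => hwc (hD.inj h).symm, h2⟩
      · rintro ⟨h1, h2⟩
        exact ⟨hTc.trans h1, h2⟩
    unfold ins
    rw [if_neg hwm, if_neg hwm]
    by_cases h : T ⊂ D w ∧ (D w ∩ N).Nonempty
    · rw [if_pos h, if_pos (this.1 h)]
    · rw [if_neg h, if_neg (fun h' => h (this.2 h'))]

/-- Rotations that involve `m` stay inside a fiber of the deletion map. -/
theorem Extends.del_eq_of_rot {D' : Fin n → Set (Fin n)} (hD : Nested H' D) (hD' : Nested H' D')
    {i : Fin n} (h : Rot D D' i m) : del m D' = del m D := by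
  funext w
  by_cases hwm : w = m
  · rw [hwm, del_self, del_self]
  by_cases hwi : w = i
  · subst hwi
    have h1 := E.cov_self hD' (hD'.cov_of_rot hD h.symm)
    rw [h.2.1] at h1
    have h2 : del m D w = D w \ {m} := by simp [del, hwm]
    have h3 : del m D' w = D' w \ {m} := by simp [del, hwm]
    rw [h2, h3, ← h1]
    simp
  · simp [del, hwm, h.2.2 w hwi hwm]

omit E in
theorem Rot.del {D' : Fin n → Set (Fin n)} {i j : Fin n} (h : Rot D D' i j) (hi : i ≠ m)
    (hj : j ≠ m) : Rot (del m D) (del m D') i j := by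
  refine ⟨h.1, ?_, fun w hwi hwj => ?_⟩
  · simp [ElimGray.del, hi, hj, h.2.1]
  · simp [ElimGray.del, h.2.2 w hwi hwj]

end

/-! ### Greedy steps on families of descendant sets. -/

/-- `D` and `D'` differ in the rotation of the edge `{i, j}`. -/
def Edge (D D' : Fin n → Set (Fin n)) (i j : Fin n) : Prop :=
  Rot D D' i j ∨ Rot D D' j i

/-- A parent has a neighbor in each child subtree, and the two ends exchange roles under the
rotation. This rules out rotations of vertices that have not been inserted yet. -/
theorem Nested.edge_not_isolated {H : SimpleGraph (Fin n)} {D D' : Fin n → Set (Fin n)}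
    (hD : Nested H D) (hD' : Nested H D') {i j : Fin n} (h : Edge D D' i j) :
    (∃ u, H.Adj i u) ∧ ∃ u, H.Adj j u := by
  have key : ∀ {i j}, Rot D D' i j → (∃ u, H.Adj i u) ∧ ∃ u, H.Adj j u := by
    intro i j h
    obtain ⟨w, -, hw⟩ := hD.cov_adj (hD.cov_of_rot hD' h)
    obtain ⟨w', -, hw'⟩ := hD'.cov_adj (hD'.cov_of_rot hD h.symm)
    exact ⟨⟨w, hw⟩, w', hw'⟩
  rcases h with h | h
  · exact key h
  · exact (key h).symm

/-- A step of the greedy algorithm from `D` to `D'`, where `S` is the set of visited forests. -/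
def Step (H : SimpleGraph (Fin n)) (S : Set (Fin n → Set (Fin n))) (D D' : Fin n → Set (Fin n)) :
    Prop :=
  ∃ i j, i < j ∧ Edge D D' i j ∧ Nested H D' ∧ D' ∉ S ∧
    (∀ k, j < k → ∀ i' D'', i' < k → Edge D D'' i' k → Nested H D'' → D'' ∈ S) ∧
    (∀ i' D'', i' < j → Edge D D'' i' j → Nested H D'' → D'' ∉ S → i' = i)

/-- The greedy algorithm visits the forests in the list in this order, if the forests in `S` have
been visited before. -/
def Greedy (H : SimpleGraph (Fin n)) :
    Set (Fin n → Set (Fin n)) → List (Fin n → Set (Fin n)) → Prop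
  | _, [] => True
  | _, [_] => True
  | S, D :: D' :: M => Step H (insert D S) D D' ∧ Greedy H (insert D S) (D' :: M)

section Greedy

variable {H : SimpleGraph (Fin n)}

theorem union_mem_cons {α : Type*} (S : Set α) (a : α) (A : List α) :
    S ∪ {x | x ∈ a :: A} = insert a S ∪ {x | x ∈ A} := by
  ext x
  simp only [List.mem_cons, Set.mem_union, Set.mem_ofPred_eq, Set.mem_insert_iff]
  tauto

theorem Greedy.append {A B : List (Fin n → Set (Fin n))} :
    ∀ {S : Set (Fin n → Set (Fin n))}, Greedy H S A → Greedy H (S ∪ {x | x ∈ A}) B →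
      (∀ a ∈ A.getLast?, ∀ b ∈ B.head?, Step H (S ∪ {x | x ∈ A}) a b) → Greedy H S (A ++ B) := by
  induction A with
  | nil => intro S _ hB _; simpa using hB
  | cons a A ih =>
    intro S hA hB hAB
    rw [union_mem_cons] at hB hAB
    cases A with
    | nil =>
      cases B with
      | nil => trivial
      | cons b B =>
        simp only [List.not_mem_nil, Set.ofPred_false, Set.union_empty] at hB hAB
        exact ⟨hAB a (by simp) b (by simp), hB⟩
    | cons a' A => exact ⟨hA.1, ih hA.2 hB fun x hx => hAB x (by simpa using hx)⟩

theorem Greedy.of_steps {A : List (Fin n → Set (Fin n))} :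
    ∀ {S : Set (Fin n → Set (Fin n))}, (∀ L D D' R, A = L ++ D :: D' :: R →
      Step H (S ∪ {x | x ∈ L ++ [D]}) D D') → Greedy H S A := by
  induction A with
  | nil => intros; trivial
  | cons a A ih =>
    intro S h
    cases A with
    | nil => trivial
    | cons a' A =>
      refine ⟨?_, ih fun L D D' R hA => ?_⟩
      · have := h [] a a' A rfl
        rwa [List.nil_append, union_mem_cons, show {x | x ∈ ([] : List (Fin n → Set (Fin n)))} = ∅ by
          simp, Set.union_empty] at this
      · have := h (a :: L) D D' R (by rw [hA]; rfl)
        rwa [List.cons_append, union_mem_cons] at this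

theorem Greedy.nodup {M : List (Fin n → Set (Fin n))} :
    ∀ {S : Set (Fin n → Set (Fin n))}, Greedy H S M → (∀ D ∈ M.head?, D ∉ S) →
      M.Nodup ∧ ∀ D ∈ M, D ∉ S := by
  induction M with
  | nil => intros; simp
  | cons a M ih =>
    intro S h ha
    have ha : a ∉ S := ha a (by simp)
    cases M with
    | nil => simpa using ha
    | cons b M =>
      have hb : b ∉ insert a S := by
        obtain ⟨_, _, _, _, _, hb, _⟩ := h.1
        exact hb
      obtain ⟨h1, h2⟩ := ih h.2 (by simpa using hb)
      refine ⟨List.nodup_cons.2 ⟨fun hab => h2 a hab (Set.mem_insert _ _), h1⟩, ?_⟩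
      intro D hD
      rcases List.mem_cons.1 hD with hD | hD
      · rwa [hD]
      · exact fun hDS => h2 D hD (Set.mem_insert_of_mem _ hDS)

end Greedy

/-! ### Fibers of the deletion map and their zigzag concatenation. -/

open Classical in
/-- The positions for the insertion of a vertex, from the bottom to the top. -/
noncomputable def positionList (N : Set (Fin n)) (D : Fin n → Set (Fin n)) :
    List (Set (Fin n)) :=
  (Set.toFinite (positions N D)).toFinset.toList.mergeSort
    (fun A B => decide (A.ncard ≤ B.ncard))

/-- The topmost position for the insertion of a vertex. -/
def topPosition (N : Set (Fin n)) (D : Fin n → Set (Fin n)) : Set (Fin n) := ⋃₀ positions N D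

/-- The forests that arise from `D` by inserting the vertex `m`, from the bottom to the top if
`b = true`, and from the top to the bottom if `b = false`. -/
noncomputable def fiber (N : Set (Fin n)) (m : Fin n) (b : Bool) (D : Fin n → Set (Fin n)) :
    List (Fin n → Set (Fin n)) :=
  if b then (positionList N D).map (ins N m D) else ((positionList N D).map (ins N m D)).reverse

/-- The forest that arises from `D` by inserting the vertex `m` at the top, if `b = true`, or at the
bottom, if `b = false`. -/
noncomputable def extreme (N : Set (Fin n)) (m : Fin n) (b : Bool) (D : Fin n → Set (Fin n)) :
    Fin n → Set (Fin n) :=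
  ins N m D (if b then topPosition N D else ∅)

/-- The vertex `m` is inserted in all possible ways into the forests in the list, alternately
from the bottom to the top and from the top to the bottom. -/
noncomputable def zigzag (N : Set (Fin n)) (m : Fin n) :
    Bool → List (Fin n → Set (Fin n)) → List (Fin n → Set (Fin n))
  | _, [] => []
  | b, D :: M => fiber N m b D ++ zigzag N m (!b) M

section

variable {H H' : SimpleGraph (Fin n)} {m : Fin n} {N : Set (Fin n)}
  {D D' : Fin n → Set (Fin n)} {T : Set (Fin n)}

theorem mem_positionList : T ∈ positionList N D ↔ T ∈ positions N D := by
  simp [positionList, List.mem_mergeSort]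

theorem nodup_positionList : (positionList N D).Nodup := by
  rw [positionList, (List.mergeSort_perm _ _).nodup_iff]
  exact Finset.nodup_toList _

theorem empty_mem_positions : ∅ ∈ positions N D := Or.inl rfl

theorem subset_topPosition (hT : T ∈ positions N D) : T ⊆ topPosition N D :=
  Set.subset_sUnion_of_mem hT

theorem ins_apply_self : ins N m D T m = insert m T := by simp [ins]

theorem ins_top_apply {v : Fin n} (hv : v ≠ m) : ins N m D (topPosition N D) v = D v := by
  unfold ins
  rw [if_neg hv, if_neg]
  rintro ⟨h1, h2⟩
  exact h1.2 (subset_topPosition (Or.inr ⟨v, rfl, h2⟩))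

theorem pairwise_consecutive {α : Type*} {R : α → α → Prop} {l L M : List α} {a b : α}
    (h : l.Pairwise R) (hl : l = L ++ a :: b :: M) :
    (∀ x ∈ L, R x a) ∧ R a b ∧ ∀ x ∈ M, R b x := by
  subst hl
  rw [List.pairwise_append, List.pairwise_cons, List.pairwise_cons] at h
  exact ⟨fun x hx => h.2.2 x hx a (by simp), h.2.1.1 b (by simp), h.2.1.2.1⟩

variable (E : Extends H H' m N)
include E

theorem Extends.positions_total (hD : Nested H D) {A B : Set (Fin n)} (hA : A ∈ positions N D)
    (hB : B ∈ positions N D) : A ⊆ B ∨ B ⊆ A := by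
  rcases hA with rfl | ⟨a, rfl, ha⟩
  · exact Or.inl (Set.empty_subset _)
  rcases hB with rfl | ⟨b, rfl, hb⟩
  · exact Or.inr (Set.empty_subset _)
  exact (hD.comparable E.clique ha hb).imp hD.trans hD.trans

/-- The positions form a chain, so sorting by cardinality sorts by inclusion, strictly because there
are no repetitions. -/
theorem Extends.pairwise_positionList (hD : Nested H D) :
    (positionList N D).Pairwise (· ⊂ ·) := by
  have h1 : (positionList N D).Pairwise (fun A B => A.ncard ≤ B.ncard) := by
    have := List.pairwise_mergeSort (le := fun A B : Set (Fin n) => decide (A.ncard ≤ B.ncard))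
      (fun a b c h1 h2 => by simp only [decide_eq_true_eq] at *; exact h1.trans h2)
      (fun a b => by simpa using le_total a.ncard b.ncard)
      (Set.toFinite (positions N D)).toFinset.toList
    exact this.imp (by simp)
  refine (h1.and nodup_positionList).imp_of_mem ?_
  rintro A B hA hB ⟨hle, hne⟩
  rcases E.positions_total hD (mem_positionList.1 hA) (mem_positionList.1 hB) with h | h
  · exact h.ssubset_of_ne hne
  · exact absurd (Set.eq_of_subset_of_ncard_le h hle (Set.toFinite _)).symm hne

theorem Extends.topPosition_mem (hD : Nested H D) : topPosition N D ∈ positions N D ∧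
    topPosition N D ≠ ∅ := by
  obtain ⟨y, hy⟩ := E.nonempty
  obtain ⟨r, -, hyr, htop⟩ := hD.exists_top (Set.mem_univ y)
  have hr : (D r ∩ N).Nonempty := ⟨y, hyr, hy⟩
  have : topPosition N D = D r := by
    refine (Set.sUnion_subset ?_).antisymm (subset_topPosition (Or.inr ⟨r, rfl, hr⟩))
    rintro T (rfl | ⟨c, rfl, hc⟩)
    · exact Set.empty_subset _
    · rcases hD.comparable E.clique hc hr with h | h
      · exact hD.trans h
      · rw [htop c trivial h]
  rw [this]
  exact ⟨Or.inr ⟨r, rfl, hr⟩, Set.Nonempty.ne_empty ⟨r, hD.self r⟩⟩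

omit E in
-- The right side does not mention `D`: the top position is the same for all forests, which lets
-- rotations lift when `m` is at the top.
theorem Nested.topPosition_eq (hD : Nested H D) : topPosition N D =
    {u | ∃ C, IsComponent H Set.univ C ∧ u ∈ C ∧ (C ∩ N).Nonempty} := by
  ext u
  constructor
  · rintro ⟨T, rfl | ⟨c, rfl, hc⟩, hu⟩
    · exact absurd hu (by simp)
    · obtain ⟨r, -, hcr, htop⟩ := hD.exists_top (Set.mem_univ c)
      exact ⟨D r, hD.isComponent_of_top (fun _ _ => Set.subset_univ _) trivial htop,
        hD.trans hcr hu, hc.mono (Set.inter_subset_inter_left _ (hD.trans hcr))⟩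
  · rintro ⟨C, hC, hu, hne⟩
    obtain ⟨c, -, -, rfl⟩ := hD.eq_of_isComponent (fun _ _ => Set.subset_univ _) hC
    exact ⟨D c, Or.inr ⟨c, rfl, hne⟩, hu⟩

theorem Extends.head_positionList (hD : Nested H D) : (positionList N D).head? = some ∅ := by
  have hp := E.pairwise_positionList hD
  have hmem := mem_positionList.2 (empty_mem_positions (N := N) (D := D))
  cases h : positionList N D with
  | nil => rw [h] at hmem; cases hmem
  | cons T R =>
    rw [h] at hmem hp
    rcases List.mem_cons.1 hmem with rfl | hR
    · rfl
    · exact absurd ((List.pairwise_cons.1 hp).1 _ hR) (fun h => h.2 (Set.empty_subset _))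

theorem Extends.getLast_positionList (hD : Nested H D) :
    (positionList N D).getLast? = some (topPosition N D) := by
  have hp := E.pairwise_positionList hD
  have hmem := mem_positionList.2 (E.topPosition_mem hD).1
  rcases List.eq_nil_or_concat (positionList N D) with h | ⟨R, T, h⟩
  · rw [h] at hmem; cases hmem
  · have hT : T ∈ positions N D := mem_positionList.1 (by rw [h]; simp)
    rw [List.concat_eq_append] at h
    rw [h] at hmem hp ⊢
    rw [List.getLast?_concat]
    congr 1
    rcases List.mem_append.1 hmem with hR | hR
    · have := (List.pairwise_append.1 hp).2.2 _ hR T (by simp)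
      exact absurd (subset_topPosition hT) this.2
    · simpa using (List.mem_singleton.1 hR).symm

theorem Extends.mem_fiber (hD : Nested H D) {b : Bool} {x : Fin n → Set (Fin n)} :
    x ∈ fiber N m b D ↔ Nested H' x ∧ del m x = D := by
  have : x ∈ fiber N m b D ↔ ∃ T ∈ positions N D, ins N m D T = x := by
    unfold fiber
    split_ifs <;> simp [mem_positionList]
  rw [this]
  constructor
  · rintro ⟨T, hT, rfl⟩
    exact ⟨E.nested_ins hD hT, E.del_ins hD⟩
  · rintro ⟨hx, rfl⟩
    exact ⟨_, E.diff_mem_positions hx, E.ins_del hx⟩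

theorem Extends.head_fiber (hD : Nested H D) {b : Bool} :
    (fiber N m b D).head? = some (extreme N m (!b) D) := by
  cases b <;> simp [fiber, extreme, E.head_positionList hD, E.getLast_positionList hD]

theorem Extends.getLast_fiber (hD : Nested H D) {b : Bool} :
    (fiber N m b D).getLast? = some (extreme N m b D) := by
  cases b <;> simp [fiber, extreme, E.head_positionList hD, E.getLast_positionList hD]

theorem Extends.lt_of_adj {i u : Fin n} (him : i ≠ m) (h : H'.Adj i u) : i < m := by
  by_contra hcon
  exact E.isolated_of_lt (lt_of_le_of_ne (not_lt.1 hcon) him.symm) u h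

/-- Larger vertices are isolated, so `m` is the largest candidate. It has at most one parent and one
child; the visited forests on the side `m` came from exclude the opposite direction. -/
theorem Extends.step_of_rot {c c' : Fin n → Set (Fin n)} {V : Set (Fin n → Set (Fin n))}
    {i : Fin n} (hc : Nested H' c) (hc' : Nested H' c') (hV : c' ∉ V)
    (h : (Rot c c' i m ∧ ∀ x, Nested H' x → del m x = del m c → x m ⊂ c m → x ∈ V) ∨
      (Rot c c' m i ∧ ∀ x, Nested H' x → del m x = del m c → c m ⊂ x m → x ∈ V)) :
    Step H' V c c' := by
  have hedge : Edge c c' i m := h.imp And.left And.left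
  have him : i ≠ m := by
    rcases h with h | h
    · exact h.1.1
    · exact h.1.1.symm
  have hadj := hc.edge_not_isolated hc' hedge
  obtain ⟨u, hu⟩ := hadj.1
  refine ⟨i, m, E.lt_of_adj him hu, hedge, hc', hV, ?_, ?_⟩
  · intro k hk i' D'' _ h' hD''
    obtain ⟨u, hu⟩ := (hc.edge_not_isolated hD'' h').2
    exact absurd hu (E.isolated_of_lt hk u)
  · intro i' D'' _ h' hD'' hD''V
    have hss : ∀ {A : Fin n → Set (Fin n)} {a b}, Nested H' A → Cov A a b → A b ⊂ A a :=
      fun hA hcov => (hA.trans hcov.1).ssubset_of_ne fun h => hcov.2.1 (hA.inj h)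
    rcases h' with h' | h'
    · rcases h with ⟨h, hvis⟩ | ⟨h, hvis⟩
      · exact hc.cov_unique (hc.cov_of_rot hD'' h') (hc.cov_of_rot hc' h)
      · refine absurd (hvis D'' hD'' (E.del_eq_of_rot hc hD'' h') ?_) hD''V
        rw [h'.2.1]
        exact hss hc (hc.cov_of_rot hD'' h')
    · rcases h with ⟨h, hvis⟩ | ⟨h, hvis⟩
      · refine absurd (hvis D'' hD'' (E.del_eq_of_rot hD'' hc h'.symm).symm ?_) hD''V
        rw [← h'.2.1]
        exact hss hD'' (hD''.cov_of_rot hc h'.symm)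
      · have h1 := E.cov_self hc (hc.cov_of_rot hD'' h')
        have h2 := E.cov_self hc (hc.cov_of_rot hc' h)
        exact hc.inj (h1.symm.trans h2)

theorem Extends.exists_rot_of_consecutive (hD : Nested H D) {L R : List (Set (Fin n))}
    {T' : Set (Fin n)} (h : positionList N D = L ++ T :: T' :: R) :
    ∃ i, Rot (ins N m D T) (ins N m D T') i m := by
  have hp := pairwise_consecutive (E.pairwise_positionList hD) h
  have hT' : T' ∈ positions N D := mem_positionList.1 (by rw [h]; simp)
  rcases hT' with rfl | ⟨c, rfl, hc⟩
  · exact absurd hp.2.1 (fun h => h.2 (Set.empty_subset _))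
  · refine ⟨c, E.rot_ins_ins hD hc hp.2.1 fun w hw hTw => ?_⟩
    have hmem : D w ∈ positionList N D := mem_positionList.2 (Or.inr ⟨w, rfl, hw⟩)
    rw [h] at hmem
    rcases List.mem_append.1 hmem with h' | h'
    · exact absurd (hp.1 _ h') hTw.asymm
    rcases List.mem_cons.1 h' with h' | h'
    · exact absurd h' hTw.ne'
    rcases List.mem_cons.1 h' with h' | h'
    · rw [h']
    · exact (hp.2.2 _ h').subset

theorem Extends.mem_of_del_eq (hD : Nested H D) {x : Fin n → Set (Fin n)} (hx : Nested H' x)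
    (hxD : del m x = D) : ∃ T ∈ positionList N D, x = ins N m D T ∧ x m = insert m T := by
  subst hxD
  refine ⟨_, mem_positionList.2 (E.diff_mem_positions hx), (E.ins_del hx).symm, ?_⟩
  rw [Set.insert_sdiff_singleton, Set.insert_eq_of_mem (hx.self m)]

theorem Extends.ins_injective (hD : Nested H D) {A B : Set (Fin n)} (hA : A ∈ positionList N D)
    (h : insert m A ⊆ insert m B) : A ⊆ B := by
  intro x hx
  rcases h (Set.mem_insert_of_mem m hx) with rfl | h
  · exact absurd hx (E.notMem_position hD (mem_positionList.1 hA))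
  · exact h

/-- The set of previously visited forests is the union of the fibers over `S`. Sweeping `m`
monotonically leaves only unvisited positions ahead and only visited ones behind. -/
theorem Extends.greedy_fiber (hD : Nested H D) {S : Set (Fin n → Set (Fin n))} (hDS : D ∉ S)
    (b : Bool) : Greedy H' {x | Nested H' x ∧ del m x ∈ S} (fiber N m b D) := by
  have hp := E.pairwise_positionList hD
  have key : ∀ L T T' R, positionList N D = L ++ T :: T' :: R →
      (∀ x ∈ L, x ⊂ T) ∧ T ⊂ T' ∧ (∀ x ∈ R, T' ⊂ x) ∧ T ∈ positionList N D ∧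
        T' ∈ positionList N D := by
    intro L T T' R h
    obtain ⟨h1, h2, h3⟩ := pairwise_consecutive hp h
    exact ⟨h1, h2, h3, by rw [h]; simp, by rw [h]; simp⟩
  have nested : ∀ {T}, T ∈ positionList N D → Nested H' (ins N m D T) :=
    fun hT => E.nested_ins hD (mem_positionList.1 hT)
  have hinj : ∀ {A B}, A ∈ positionList N D → B ∈ positionList N D →
      ins N m D A = ins N m D B → A = B := by
    intro A B hA hB h
    have h : insert m A = insert m B := by rw [← ins_apply_self (N := N) (D := D), h, ins_apply_self]
    exact (E.ins_injective hD hA h.subset).antisymm (E.ins_injective hD hB h.symm.subset)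
  have hout : ∀ {A}, A ∈ positionList N D →
      ins N m D A ∉ {x | Nested H' x ∧ del m x ∈ S} := by
    rintro A _ ⟨-, h⟩
    rw [E.del_ins hD] at h
    exact hDS h
  have hss : ∀ {A B}, A ∈ positionList N D → insert m A ⊂ insert m B → A ⊂ B := by
    intro A B hA h
    exact ⟨E.ins_injective hD hA h.subset, fun h' => h.2 (Set.insert_subset_insert h')⟩
  refine Greedy.of_steps fun L x y R hA => ?_
  cases b with
  | true =>
    simp only [fiber, if_true] at hA
    obtain ⟨P, Q, hPQ, rfl, hQ⟩ := List.map_eq_append_iff.1 hA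
    obtain ⟨T, Q', rfl, rfl, hQ'⟩ := List.map_eq_cons_iff.1 hQ
    obtain ⟨T', R', rfl, rfl, rfl⟩ := List.map_eq_cons_iff.1 hQ'
    obtain ⟨h1, h2, h3, hT, hT'⟩ := key _ _ _ _ hPQ
    obtain ⟨i, hi⟩ := E.exists_rot_of_consecutive hD hPQ
    have hP : ∀ B ∈ P, B ∈ positionList N D := fun B hB => by rw [hPQ]; simp [hB]
    refine E.step_of_rot (nested hT) (nested hT') ?_ (Or.inl ⟨hi, ?_⟩)
    · rintro (h | h)
      · exact hout hT' h
      · simp only [List.mem_append, List.mem_map, List.mem_singleton, Set.mem_ofPred_eq] at h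
        rcases h with ⟨B, hB, h⟩ | h
        · have := hinj (hP B hB) hT' h
          exact absurd h2 (this ▸ (h1 B hB)).asymm
        · exact absurd (hinj hT' hT h) h2.ne'
    · intro x hx hxD hxm
      rw [E.del_ins hD] at hxD
      obtain ⟨A, hA, rfl, hxm'⟩ := E.mem_of_del_eq hD hx hxD
      rw [hxm', ins_apply_self] at hxm
      have hAT := hss hA hxm
      refine Or.inr ?_
      simp only [List.mem_append, List.mem_map, List.mem_singleton, Set.mem_ofPred_eq]
      refine Or.inl ⟨A, ?_, rfl⟩
      rw [hPQ] at hA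
      rcases List.mem_append.1 hA with h | h
      · exact h
      rcases List.mem_cons.1 h with h | h
      · exact absurd h hAT.ne
      rcases List.mem_cons.1 h with rfl | h
      · exact absurd h2 hAT.asymm
      · exact absurd (h2.trans (h3 A h)) hAT.asymm
  | false =>
    simp only [fiber, Bool.false_eq_true, if_false] at hA
    rw [← List.map_reverse] at hA
    obtain ⟨P, Q, hPQ, rfl, hQ⟩ := List.map_eq_append_iff.1 hA
    obtain ⟨T', Q', rfl, rfl, hQ'⟩ := List.map_eq_cons_iff.1 hQ
    obtain ⟨T, R', rfl, rfl, rfl⟩ := List.map_eq_cons_iff.1 hQ'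
    -- In the downward sweep the visited part `P` consists of the positions above `T'`.
    have hPQ : positionList N D = R'.reverse ++ T :: T' :: P.reverse := by
      rw [List.reverse_eq_iff] at hPQ
      rw [hPQ]
      simp
    obtain ⟨h1, h2, h3, hT, hT'⟩ := key _ _ _ _ hPQ
    obtain ⟨i, hi⟩ := E.exists_rot_of_consecutive hD hPQ
    have hP : ∀ B ∈ P, B ∈ positionList N D := fun B hB => by rw [hPQ]; simp [hB]
    refine E.step_of_rot (nested hT') (nested hT) ?_ (Or.inr ⟨hi.symm, ?_⟩)
    · rintro (h | h)
      · exact hout hT h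
      · simp only [List.mem_append, List.mem_map, List.mem_singleton, Set.mem_ofPred_eq] at h
        rcases h with ⟨B, hB, h⟩ | h
        · have := hinj (hP B hB) hT h
          exact absurd h2 (this ▸ (h3 B (by simpa using hB))).asymm
        · exact absurd (hinj hT hT' h) h2.ne
    · intro x hx hxD hxm
      rw [E.del_ins hD] at hxD
      obtain ⟨A, hA, rfl, hxm'⟩ := E.mem_of_del_eq hD hx hxD
      rw [hxm', ins_apply_self] at hxm
      have hAT := hss hT' hxm
      refine Or.inr ?_
      simp only [List.mem_append, List.mem_map, List.mem_singleton, Set.mem_ofPred_eq]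
      refine Or.inl ⟨A, ?_, rfl⟩
      rw [hPQ] at hA
      rcases List.mem_append.1 hA with h | h
      · exact absurd ((h1 A h).trans h2) hAT.asymm
      rcases List.mem_cons.1 h with rfl | h
      · exact absurd h2 hAT.asymm
      rcases List.mem_cons.1 h with h | h
      · exact absurd h hAT.ne'
      · simpa using h

/-- At the bottom, whether `m` joins the set of a vertex depends only on that set; at the top, no
other set changes and the set of `m` depends only on `H`. Either way the rotation is undisturbed. -/
theorem Extends.edge_extreme (hD : Nested H D) (hD' : Nested H D') {i j : Fin n}
    (h : Edge D D' i j) (b : Bool) : Edge (extreme N m b D) (extreme N m b D') i j := by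
  have hadj := hD.edge_not_isolated hD' h
  have him : i ≠ m := by
    rintro rfl
    exact E.isolated i le_rfl _ hadj.1.choose_spec
  have hjm : j ≠ m := by
    rintro rfl
    exact E.isolated j le_rfl _ hadj.2.choose_spec
  have key : ∀ {i j}, i ≠ m → j ≠ m → Rot D D' i j →
      Rot (extreme N m b D) (extreme N m b D') i j := by
    intro i j hi hj h
    cases b with
    | true =>
      simp only [extreme, if_true]
      refine ⟨h.1, ?_, fun w hwi hwj => ?_⟩
      · rw [ins_top_apply hi, ins_top_apply hj, h.2.1]
      · by_cases hw : w = m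
        · rw [hw, ins_apply_self, ins_apply_self, hD.topPosition_eq, hD'.topPosition_eq]
        · rw [ins_top_apply hw, ins_top_apply hw, h.2.2 w hwi hwj]
    | false =>
      simp only [extreme, Bool.false_eq_true, if_false]
      refine ⟨h.1, ?_, fun w hwi hwj => ?_⟩
      · simp only [ins, if_neg hi, if_neg hj]
        rw [h.2.1]
      · simp only [ins]
        rw [h.2.2 w hwi hwj]
  exact h.imp (key him hjm) (key hjm him)

theorem Extends.extreme_nested (hD : Nested H D) (b : Bool) : Nested H' (extreme N m b D) := by
  refine E.nested_ins hD ?_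
  split_ifs
  · exact (E.topPosition_mem hD).1
  · exact empty_mem_positions

theorem Extends.del_extreme (hD : Nested H D) (b : Bool) : del m (extreme N m b D) = D :=
  E.del_ins hD

/-- Rotations of vertices below `m` project to rotations of `D`, so maximality and uniqueness are
inherited. Rotations of `m` stay over `D`, where `hDS` says that everything is visited, and larger
vertices are isolated. -/
theorem Extends.step_extreme (hD : Nested H D) {S : Set (Fin n → Set (Fin n))} (hDS : D ∈ S)
    (h : Step H S D D') (b : Bool) :
    Step H' {x | Nested H' x ∧ del m x ∈ S} (extreme N m b D) (extreme N m b D') := by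
  obtain ⟨i, j, hij, hedge, hD', hD'S, hmax, huniq⟩ := h
  have hc := E.extreme_nested hD b
  have hjm : j < m := by
    obtain ⟨u, hu⟩ := (hD.edge_not_isolated hD' hedge).2
    by_contra hcon
    exact E.isolated j (not_lt.1 hcon) u hu
  have hdel : ∀ {i' k D''}, i' < k → k < m → Edge (extreme N m b D) D'' i' k →
      Edge D (del m D'') i' k := by
    intro i' k D'' hi' hk h
    have := h.imp (fun h => h.del (hi'.trans hk).ne hk.ne) (fun h => h.del hk.ne (hi'.trans hk).ne)
    rwa [E.del_extreme hD] at this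
  refine ⟨i, j, hij, E.edge_extreme hD hD' hedge b, E.extreme_nested hD' b, ?_, ?_, ?_⟩
  · rintro ⟨-, h⟩
    rw [E.del_extreme hD'] at h
    exact hD'S h
  · intro k hk i' D'' hi' h' hD''
    refine ⟨hD'', ?_⟩
    rcases lt_trichotomy k m with hkm | rfl | hkm
    · exact hmax k hk i' _ hi' (hdel hi' hkm h') (E.nested_del hD'')
    · rcases h' with h' | h'
      · rw [E.del_eq_of_rot hc hD'' h', E.del_extreme hD]
        exact hDS
      · rw [← E.del_eq_of_rot hD'' hc h'.symm, E.del_extreme hD]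
        exact hDS
    · obtain ⟨u, hu⟩ := (hc.edge_not_isolated hD'' h').2
      exact absurd hu (E.isolated_of_lt hkm u)
  · intro i' D'' hi' h' hD'' hnot
    exact huniq i' _ hi' (hdel hi' hjm h') (E.nested_del hD'') fun h => hnot ⟨hD'', h⟩

theorem Extends.head_zigzag (hD : Nested H D) {b : Bool} {M : List (Fin n → Set (Fin n))} :
    (zigzag N m b (D :: M)).head? = some (extreme N m (!b) D) := by
  simp [zigzag, List.head?_append, E.head_fiber hD]

theorem Extends.mem_zigzag {M : List (Fin n → Set (Fin n))} :
    ∀ {b : Bool}, (∀ D ∈ M, Nested H D) → ∀ x,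
      x ∈ zigzag N m b M ↔ Nested H' x ∧ del m x ∈ M := by
  induction M with
  | nil => intro b _ x; simp [zigzag]
  | cons D M ih =>
    intro b hM x
    rw [zigzag, List.mem_append, E.mem_fiber (hM D (by simp)),
      ih fun D hD => hM D (by simp [hD]), List.mem_cons]
    tauto

theorem Extends.greedy_zigzag {M : List (Fin n → Set (Fin n))} :
    ∀ {b : Bool} {S : Set (Fin n → Set (Fin n))}, (∀ D ∈ M, Nested H D) →
      (∀ D ∈ M.head?, D ∉ S) → Greedy H S M →
      Greedy H' {x | Nested H' x ∧ del m x ∈ S} (zigzag N m b M) := by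
  induction M with
  | nil => intros; trivial
  | cons D M ih =>
    intro b S hM hhead hgreedy
    have hD := hM D (by simp)
    -- Completing one fiber amounts to adding `D` to the visited forests of the smaller graph.
    have hS : {x | Nested H' x ∧ del m x ∈ S} ∪ {x | x ∈ fiber N m b D} =
        {x | Nested H' x ∧ del m x ∈ insert D S} := by
      ext x
      simp only [Set.mem_union, Set.mem_ofPred_eq, E.mem_fiber hD, Set.mem_insert_iff]
      tauto
    refine Greedy.append (E.greedy_fiber hD (hhead D (by simp)) b) ?_ ?_
    · rw [hS]
      cases M with
      | nil => trivial
      | cons D' M =>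
        refine ih (fun x hx => hM x (by simp [hx])) ?_ hgreedy.2
        obtain ⟨_, _, _, _, _, hb, _⟩ := hgreedy.1
        simpa using hb
    · rw [hS, E.getLast_fiber hD]
      cases M with
      | nil => simp [zigzag]
      | cons D' M =>
        rw [E.head_zigzag (hM D' (by simp))]
        rintro a ⟨⟩ c ⟨⟩
        -- The next fiber runs in the opposite direction, so it starts with `m` at the end where
        -- this one stopped.
        rw [Bool.not_not]
        exact E.step_extreme hD (Set.mem_insert _ _) hgreedy.1 b

/-- The direction alternates from fiber to fiber, so the parity of the number of fibers decides
where `m` ends up. -/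
theorem Extends.getLast_zigzag {M : List (Fin n → Set (Fin n))} :
    ∀ {b : Bool} {D : Fin n → Set (Fin n)}, (∀ D ∈ M, Nested H D) → M.getLast? = some D →
      (zigzag N m b M).getLast? = some (extreme N m (if Even M.length then !b else b) D) := by
  induction M with
  | nil => intro b D _ h; cases h
  | cons D M ih =>
    intro b L hM hL
    cases M with
    | nil =>
      obtain rfl : D = L := by simpa using hL
      simp [zigzag, E.getLast_fiber (hM D (by simp))]
    | cons D' M =>
      have := ih (b := !b) (fun x hx => hM x (by simp [hx])) (D := L) (by simpa using hL)
      rw [zigzag, List.getLast?_append, this, Option.some_or, List.length_cons (a := D)]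
      congr 2
      by_cases h : Even (D' :: M).length
      · rw [if_pos h, if_neg (by rw [Nat.even_add_one]; simpa using h), Bool.not_not]
      · rw [if_neg h, if_pos (by rw [Nat.even_add_one]; exact h)]

end

/-! ### The Gray code by induction along the elimination ordering. -/

/-- The graph `G` in which all vertices from `m` on are isolated. -/
def cut (G : SimpleGraph (Fin n)) (m : ℕ) : SimpleGraph (Fin n) where
  Adj u v := G.Adj u v ∧ u.1 < m ∧ v.1 < m
  symm := ⟨fun _ _ h => ⟨h.1.symm, h.2.2, h.2.1⟩⟩
  loopless := ⟨fun _ h => h.1.ne rfl⟩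

/-- The neighbors of `m` that are smaller than `m`. -/
def smallerNeighbors (G : SimpleGraph (Fin n)) (m : Fin n) : Set (Fin n) :=
  {v | v < m ∧ G.Adj m v}

open Classical in
/-- The Gray code for the elimination forests of `cut G m`. -/
noncomputable def grayCode (G : SimpleGraph (Fin n)) : ℕ → List (Fin n → Set (Fin n))
  | 0 => [fun v => {v}]
  | m + 1 =>
    if h : m < n then
      if (smallerNeighbors G ⟨m, h⟩).Nonempty then
        zigzag (smallerNeighbors G ⟨m, h⟩) ⟨m, h⟩ true (grayCode G m)
      else grayCode G m
    else grayCode G m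

/-- The list `M` contains all elimination forests for `H` in the order in which the greedy algorithm
visits them, starting from the forest in which every vertex is smaller than its descendants. -/
structure GreedyCode (H : SimpleGraph (Fin n)) (M : List (Fin n → Set (Fin n))) : Prop where
  mem : ∀ D, D ∈ M ↔ Nested H D
  greedy : Greedy H ∅ M
  head : ∃ D, M.head? = some D ∧ ∀ v, ∀ u ∈ D v, v ≤ u

theorem GreedyCode.nodup {H : SimpleGraph (Fin n)} {M : List (Fin n → Set (Fin n))}
    (h : GreedyCode H M) : M.Nodup :=
  (h.greedy.nodup (by simp)).1

theorem GreedyCode.zigzag {H H' : SimpleGraph (Fin n)} {m : Fin n} {N : Set (Fin n)}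
    (E : Extends H H' m N) {M : List (Fin n → Set (Fin n))} (h : GreedyCode H M) :
    GreedyCode H' (zigzag N m true M) := by
  have hM : ∀ D ∈ M, Nested H D := fun D hD => (h.mem D).1 hD
  refine ⟨fun D => ?_, ?_, ?_⟩
  · rw [E.mem_zigzag hM, h.mem]
    exact ⟨And.left, fun hD => ⟨hD, E.nested_del hD⟩⟩
  · simpa using E.greedy_zigzag (b := true) hM (by simp) h.greedy
  · obtain ⟨D, hD, hmin⟩ := h.head
    cases M with
    | nil => cases hD
    | cons D' M =>
      obtain rfl : D' = D := by simpa using hD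
      have hD := hM D' (by simp)
      refine ⟨_, E.head_zigzag hD, fun v u hu => ?_⟩
      simp only [extreme, Bool.not_true, Bool.false_eq_true, if_false] at hu
      by_cases hv : v = m
      -- The first forest inserts `m` as a leaf; in the last two cases its ancestors are bounded
      -- through the vertices of `N`, all smaller than `m`.
      · rw [hv] at hu ⊢
        rcases mem_ins_self.1 hu with rfl | hu
        · exact le_rfl
        · exact absurd hu (by simp)
      by_cases hum : u = m
      · rw [hum] at hu ⊢
        obtain ⟨-, y, hy, hyN⟩ := (self_mem_ins hv (E.notMem hD hv)).1 hu
        exact (hmin v y hy).trans (E.lt y hyN).le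
      · exact hmin v u ((mem_ins hv hum).1 hu)

theorem extends_cut {G : SimpleGraph (Fin n)} (hG : IsPEO G) {m : ℕ} (h : m < n)
    (hne : (smallerNeighbors G ⟨m, h⟩).Nonempty) :
    Extends (cut G m) (cut G (m + 1)) ⟨m, h⟩ (smallerNeighbors G ⟨m, h⟩) := by
  refine ⟨?_, ?_, fun v hv => hv.1, ?_, hne⟩
  · rintro v hv u ⟨-, hvm, -⟩
    exact absurd (Fin.le_def.1 hv) (by simpa using hvm)
  · intro u v
    simp only [cut, smallerNeighbors, Set.mem_ofPred_eq, Fin.lt_def, Fin.ext_iff]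
    constructor
    · rintro ⟨huv, hu, hv⟩
      have hne : u.1 ≠ v.1 := fun h => huv.ne (Fin.ext h)
      by_cases hum : u.1 = m
      · refine Or.inr (Or.inl ⟨hum, by omega, ?_⟩)
        rwa [show (⟨m, h⟩ : Fin n) = u from Fin.ext hum.symm]
      by_cases hvm : v.1 = m
      · refine Or.inr (Or.inr ⟨hvm, by omega, ?_⟩)
        rw [show (⟨m, h⟩ : Fin n) = v from Fin.ext hvm.symm]
        exact huv.symm
      exact Or.inl ⟨huv, by omega, by omega⟩
    · rintro (⟨huv, hu, hv⟩ | ⟨hu, hv, hadj⟩ | ⟨hv, hu, hadj⟩)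
      · exact ⟨huv, by omega, by omega⟩
      · rw [show (⟨m, h⟩ : Fin n) = u from Fin.ext hu.symm] at hadj
        exact ⟨hadj, by omega, by omega⟩
      · rw [show (⟨m, h⟩ : Fin n) = v from Fin.ext hv.symm] at hadj
        exact ⟨hadj.symm, by omega, by omega⟩
  · intro u hu v hv huv
    exact ⟨hG ⟨m, h⟩ (Or.inr hu) (Or.inr hv) huv, hu.1, hv.1⟩

theorem cut_succ_of_empty {G : SimpleGraph (Fin n)} {m : ℕ} (h : m < n)
    (hne : ¬ (smallerNeighbors G ⟨m, h⟩).Nonempty) : cut G (m + 1) = cut G m := by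
  have key : ∀ {u v : Fin n}, G.Adj u v → u.1 < m + 1 → v.1 < m + 1 → u.1 < m := by
    intro u v huv hu hv
    by_contra hum
    have hum : u = ⟨m, h⟩ := Fin.ext (by simp only; omega)
    have hne' : u.1 ≠ v.1 := fun h => huv.ne (Fin.ext h)
    subst hum
    refine hne ⟨v, Fin.lt_def.2 ?_, huv⟩
    simp only at hne' ⊢
    omega
  ext u v
  constructor
  · rintro ⟨huv, hu, hv⟩
    exact ⟨huv, key huv hu hv, key huv.symm hv hu⟩
  · rintro ⟨huv, hu, hv⟩
    exact ⟨huv, by omega, by omega⟩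

theorem cut_self (G : SimpleGraph (Fin n)) : cut G n = G := by
  ext u v
  exact ⟨And.left, fun h => ⟨h, u.2, v.2⟩⟩

theorem grayCode_succ {G : SimpleGraph (Fin n)} {m : ℕ} (h : m < n)
    (hne : (smallerNeighbors G ⟨m, h⟩).Nonempty) :
    grayCode G (m + 1) = zigzag (smallerNeighbors G ⟨m, h⟩) ⟨m, h⟩ true (grayCode G m) := by
  rw [grayCode, dif_pos h, if_pos hne]

theorem greedyCode_grayCode {G : SimpleGraph (Fin n)} (hG : IsPEO G) (m : ℕ) (hm : m ≤ n) :
    GreedyCode (cut G m) (grayCode G m) := by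
  induction m with
  | zero =>
    have hiso : ∀ v u, ¬ (cut G 0).Adj v u := fun v u h => absurd h.2.1 (by omega)
    refine ⟨fun D => ?_, trivial, fun v => {v}, rfl, ?_⟩
    · rw [grayCode, List.mem_singleton]
      constructor
      · rintro rfl
        refine ⟨fun v => rfl, ?_, ?_, ?_, ?_, fun v => conn_singleton v⟩
        · rintro u v rfl
          exact subset_rfl
        · rintro u v rfl -
          rfl
        · rintro u v w rfl rfl
          exact Or.inl rfl
        · intro u v h
          exact absurd h (hiso u v)
      · exact fun hD => funext fun v => hD.eq_singleton (hiso v)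
    · rintro v u rfl
      exact le_rfl
  | succ m ih =>
    have ih := ih (by omega)
    by_cases hne : (smallerNeighbors G ⟨m, hm⟩).Nonempty
    · rw [grayCode_succ hm hne]
      exact ih.zigzag (extends_cut hG hm hne)
    · have h : m < n := hm
      rw [grayCode, dif_pos h, if_neg hne, cut_succ_of_empty hm hne]
      exact ih

/-- In such a forest `D v` is the component of `v` among the vertices `≥ v`. This identifies the
head of the list with the initial forest. -/
theorem Nested.eq_of_le {H : SimpleGraph (Fin n)} {D D' : Fin n → Set (Fin n)} (hD : Nested H D)
    (hD' : Nested H D') (h : ∀ v, ∀ u ∈ D v, v ≤ u) (h' : ∀ v, ∀ u ∈ D' v, v ≤ u) : D = D' := by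
  have key : ∀ {D : Fin n → Set (Fin n)}, Nested H D → (∀ v, ∀ u ∈ D v, v ≤ u) →
      ∀ v, IsComponent H (Set.Ici v) (D v) := by
    intro D hD h v
    refine hD.isComponent_of_top (fun b hb u hu => ?_) Set.self_mem_Ici fun b hb hv => ?_
    · exact le_trans (Set.mem_Ici.1 hb) (h b u hu)
    · exact le_antisymm (h b v hv) hb
  funext v
  exact (key hD h v).eq_of_mem (key hD' h' v) (hD.self v) (hD'.self v)

/-! ### From the list of families back to Algorithm R. -/

theorem initialForest_le (G : SimpleGraph (Fin n)) (v u : Fin n)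
    (hu : u ∈ (initialForest G).desc v) : v ≤ u := by
  classical
  have key : ∀ w u, increasingParent G w = some u → u < w := by
    intro w u h
    unfold increasingParent at h
    split_ifs at h with hne
    have := Finset.max'_mem _ hne
    rw [Option.some.inj h] at this
    simp only [removedBefore, Finset.mem_filter] at this
    exact this.2.1
  replace hu : Relation.ReflTransGen (fun u w => increasingParent G u = some w) u v := hu
  induction hu with
  | refl => exact le_rfl
  | tail _ hbc ih => exact (key _ _ hbc).le.trans ih

theorem GreedyCode.exists_list {G : SimpleGraph (Fin n)} {M : List (Fin n → Set (Fin n))}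
    (h : GreedyCode G M) : ∃ L : List (ElimForest G), L.map ElimForest.desc = M ∧ (∀ F, F ∈ L) ∧
      L.Nodup ∧ L.length = Fintype.card (ElimForest G) := by
  classical
  have : ∃ L : List (ElimForest G), L.map ElimForest.desc = M := by
    have := h.mem
    have hM : ∀ D ∈ M, ∃ F : ElimForest G, F.desc = D :=
      fun D hD => ((h.mem D).1 hD).exists_elimForest
    clear this h
    induction M with
    | nil => exact ⟨[], rfl⟩
    | cons D M ih =>
      obtain ⟨F, rfl⟩ := hM D (by simp)
      obtain ⟨L, rfl⟩ := ih fun D hD => hM D (by simp [hD])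
      exact ⟨F :: L, rfl⟩
  obtain ⟨L, rfl⟩ := this
  have hmem : ∀ F, F ∈ L := by
    intro F
    obtain ⟨F', hF', heq⟩ := List.mem_map.1 ((h.mem F.desc).2 F.nested)
    exact ElimForest.desc_injective heq ▸ hF'
  have hnodup := h.nodup.of_map
  refine ⟨L, rfl, hmem, hnodup, ?_⟩
  rw [← List.toFinset_card_of_nodup hnodup, ← Finset.card_univ]
  congr 1
  ext F
  simp [hmem F]

/-- `L` holds the forests visited before `F`, and `F :: R` is the predicted continuation. As
`continueGreedy` picks a successor by choice, existence of the predicted successor is not enough;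
its uniqueness is needed too. -/
theorem continueGreedy_eq {G : SimpleGraph (Fin n)} {R : List (ElimForest G)} :
    ∀ {L : List (ElimForest G)} {F : ElimForest G}, (∀ X, X ∈ L ++ F :: R) →
      Greedy G {x | ∃ X ∈ L, X.desc = x} ((F :: R).map ElimForest.desc) →
      continueGreedy (L ++ [F]) = L ++ F :: R := by
  induction R with
  | nil =>
    intro L F hall _
    rw [continueGreedy, dif_neg]
    rintro ⟨F', F'', -, i, j, ⟨-, -, h⟩, -⟩
    exact h (hall F')
  | cons F' R ih =>
    intro L F hall hgreedy
    have hV : insert F.desc {x | ∃ X ∈ L, X.desc = x} = {x | ∃ X ∈ L ++ [F], X.desc = x} := by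
      ext x
      constructor
      · rintro (rfl | ⟨X, hX, rfl⟩)
        · exact ⟨F, by simp, rfl⟩
        · exact ⟨X, by simp [hX], rfl⟩
      · rintro ⟨X, hX, rfl⟩
        rcases List.mem_append.1 hX with hX | hX
        · exact Or.inr ⟨X, hX, rfl⟩
        · exact Or.inl (by rw [List.mem_singleton.1 hX])
    have hmem : ∀ X : ElimForest G,
        X.desc ∈ {x | ∃ X ∈ L ++ [F], X.desc = x} ↔ X ∈ L ++ [F] := by
      intro X
      constructor
      · rintro ⟨Y, hY, h⟩
        exact ElimForest.desc_injective h ▸ hY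
      · exact fun h => ⟨X, h, rfl⟩
    obtain ⟨hstep, hrest⟩ := hgreedy
    rw [hV] at hstep hrest
    obtain ⟨i, j, hij, hedge, -, hF', hmax, huniq⟩ := hstep
    have hoption : ∀ X a b, IsOption (L ++ [F]) F X a b ↔
        a < b ∧ Edge F.desc X.desc a b ∧ X.desc ∉ {x | ∃ X ∈ L ++ [F], X.desc = x} := by
      intro X a b
      rw [IsOption, isRotation_iff, hmem X]
      rfl
    have hnext : IsNext (L ++ [F]) F' := by
      refine ⟨F, by simp, i, j, (hoption _ _ _).2 ⟨hij, hedge, hF'⟩, ?_, ?_⟩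
      · rintro k hk ⟨i', X, hX⟩
        obtain ⟨h1, h2, h3⟩ := (hoption _ _ _).1 hX
        exact h3 (hmax k hk i' _ h1 h2 X.nested)
      · intro i' X hX
        obtain ⟨h1, h2, h3⟩ := (hoption _ _ _).1 hX
        exact huniq i' _ h1 h2 X.nested h3
    have hunique : ∀ X, IsNext (L ++ [F]) X → X = F' := by
      rintro X ⟨Y, hY, a, b, hX, hmaxX, -⟩
      obtain rfl : F = Y := by simpa using hY
      obtain ⟨h1, h2, h3⟩ := (hoption _ _ _).1 hX
      have hb : b = j := by
        rcases lt_trichotomy b j with h | h | h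
        · exact absurd ⟨i, F', (hoption _ _ _).2 ⟨hij, hedge, hF'⟩⟩ (hmaxX j h)
        · exact h
        · exact absurd (hmax b h a _ h1 h2 X.nested) h3
      subst hb
      obtain rfl := huniq a _ h1 h2 X.nested h3
      -- `u` cannot be both parent and child of `v`, so the edge determines the direction of the
      -- rotation, and `rot_det` determines the result.
      have hno : ∀ {A B : ElimForest G} {u v}, Rot F.desc A.desc u v → Rot F.desc B.desc v u →
          False := fun h h' => h.1 (F.nested.antisymm
            (F.nested.cov_of_rot (ElimForest.nested _) h').1
            (F.nested.cov_of_rot (ElimForest.nested _) h).1)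
      refine ElimForest.desc_injective ?_
      rcases hedge with h | h <;> rcases h2 with h' | h'
      · exact F.nested.rot_det X.nested F'.nested h' h
      · exact (hno h h').elim
      · exact (hno h h').elim
      · exact F.nested.rot_det X.nested F'.nested h' h
    have hex : ∃ X, IsNext (L ++ [F]) X := ⟨F', hnext⟩
    rw [continueGreedy, dif_pos hex, hunique _ hex.choose_spec, ih]
    · simp
    · simpa using hall
    · exact hrest

theorem map_desc_greedyRotations {G : SimpleGraph (Fin n)} {M : List (Fin n → Set (Fin n))}
    (h : GreedyCode G M) : (greedyRotations G).map ElimForest.desc = M ∧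
      (∀ F, F ∈ greedyRotations G) ∧ (greedyRotations G).Nodup := by
  obtain ⟨L, rfl, hall, hnodup, -⟩ := h.exists_list
  obtain ⟨D, hD, hmin⟩ := h.head
  cases L with
  | nil => cases hD
  | cons F R =>
    obtain rfl : F.desc = D := by simpa using hD
    have hF : initialForest G = F := ElimForest.desc_injective
      ((initialForest G).nested.eq_of_le F.nested (initialForest_le G) hmin)
    have := continueGreedy_eq (L := []) (F := F) (R := R) (by simpa using hall)
      (by simpa using h.greedy)
    have heq : greedyRotations G = F :: R := by
      rw [greedyRotations, hF]
      exact this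
    rw [heq]
    exact ⟨rfl, hall, hnodup⟩

theorem rotationAdj_iff {G : SimpleGraph (Fin n)} {F F' : ElimForest G} :
    RotationAdj F F' ↔ ∃ i j, Edge F.desc F'.desc i j := by
  simp only [RotationAdj, isRotation_iff, Edge]

theorem Greedy.isChain {G : SimpleGraph (Fin n)} {L : List (ElimForest G)} :
    ∀ {S}, Greedy G S (L.map ElimForest.desc) → L.IsChain RotationAdj := by
  induction L with
  | nil => intros; simp
  | cons F L ih =>
    intro S h
    cases L with
    | nil => simp
    | cons F' L =>
      obtain ⟨⟨i, j, -, hedge, -⟩, h2⟩ := h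
      exact List.isChain_cons_cons.2 ⟨rotationAdj_iff.2 ⟨i, j, hedge⟩, ih h2⟩

theorem isRotationGrayCode_greedyRotations {G : SimpleGraph (Fin n)}
    {M : List (Fin n → Set (Fin n))} (h : GreedyCode G M) :
    IsRotationGrayCode (greedyRotations G) := by
  obtain ⟨h1, h2, h3⟩ := map_desc_greedyRotations h
  exact ⟨h2, h3, Greedy.isChain (S := ∅) (h1 ▸ h.greedy)⟩

/-- The first and the last forest in the list differ in a rotation. -/
def Cyclic (M : List (Fin n → Set (Fin n))) : Prop :=
  ∃ D D', M.head? = some D ∧ M.getLast? = some D' ∧ ∃ i j, Edge D D' i j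

theorem isCyclicList_greedyRotations {G : SimpleGraph (Fin n)}
    {M : List (Fin n → Set (Fin n))} (h : GreedyCode G M) :
    IsCyclicList (greedyRotations G) ↔ Cyclic M := by
  rw [← (map_desc_greedyRotations h).1]
  simp only [IsCyclicList, Cyclic, List.head?_map, List.getLast?_map, rotationAdj_iff,
    Option.map_eq_some_iff]
  constructor
  · rintro ⟨F, F', h1, h2, h3⟩
    exact ⟨_, _, ⟨F, h1, rfl⟩, ⟨F', h2, rfl⟩, h3⟩
  · rintro ⟨_, _, ⟨F, h1, rfl⟩, ⟨F', h2, rfl⟩, h3⟩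
    exact ⟨F, F', h1, h2, h3⟩

/-! ### Parity of the number of forests in the 2-connected case. -/

/-- Swapping the root of the tree on a 2-connected component with its only child is an involution
without fixed points. -/
theorem even_card_elimForest {H : SimpleGraph (Fin n)} {C : Set (Fin n)}
    (hC : IsComponent H Set.univ C) (hC' : ∀ v ∈ C, Conn H (C \ {v})) :
    Even (Fintype.card (ElimForest H)) := by
  classical
  set P : ElimForest H → ElimForest H → Prop :=
    fun F F' => ∃ r c, F.desc r = C ∧ Rot F.desc F'.desc r c with hP
  have hex : ∀ F, ∃ F', P F F' := by
    intro F
    obtain ⟨r, -, -, hr⟩ := F.nested.eq_of_isComponent (fun _ _ => Set.subset_univ _) hC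
    have hrC : r ∈ C := hr ▸ F.nested.self r
    have hcomp : IsComponent H (F.desc r \ {r}) (C \ {r}) := by
      rw [← hr]
      exact isComponent_iff.2 ⟨subset_rfl, hC' r hrC, fun _ _ b hb _ => hb⟩
    obtain ⟨c, hc, htop, -⟩ := F.nested.eq_of_isComponent (F.nested.diff_closed r) hcomp
    obtain ⟨i, hi⟩ := F.nested.exists_cov hc.1 (Ne.symm hc.2)
    have hir : i = r := by
      by_contra hir
      exact hi.2.1 (htop i ⟨hi.2.2 r hc.1 (Ne.symm hc.2), hir⟩ hi.1).symm
    obtain ⟨D', hD', hrot⟩ := F.nested.exists_rot (hir ▸ hi)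
    obtain ⟨F', rfl⟩ := hD'.exists_elimForest
    exact ⟨F', r, c, hr.symm, hrot⟩
  have hsymm : ∀ F F', P F F' → P F' F := by
    rintro F F' ⟨r, c, hr, hrot⟩
    exact ⟨c, r, hrot.2.1.trans hr, hrot.symm⟩
  have huniq : ∀ F F' F'', P F F' → P F F'' → F' = F'' := by
    rintro F F' F'' ⟨r, c, hr, hrot⟩ ⟨r', c', hr', hrot'⟩
    obtain rfl := F.nested.inj (hr.trans hr'.symm)
    have hrC : r ∈ C := hr ▸ F.nested.self r
    have hcomp : IsComponent H (F.desc r \ {r}) (C \ {r}) := by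
      rw [hr]
      exact isComponent_iff.2 ⟨subset_rfl, hC' r hrC, fun _ _ b hb _ => hb⟩
    have key : ∀ {c} {F' : ElimForest H}, Rot F.desc F'.desc r c → F.desc c = C \ {r} := by
      intro c F' h
      have hcov := F.nested.cov_of_rot F'.nested h
      exact (F.nested.isComponent_of_cov hcov).eq_of_mem hcomp (F.nested.self c)
        (hr ▸ ⟨hcov.1, hcov.2.1⟩)
    obtain rfl := F.nested.inj ((key hrot).trans (key hrot').symm)
    exact ElimForest.desc_injective (F.nested.rot_det F'.nested F''.nested hrot hrot')
  have hne : ∀ F, ¬ P F F := by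
    rintro F ⟨r, c, -, hrot⟩
    exact hrot.1 (F.nested.inj hrot.2.1).symm
  choose σ hσ using hex
  -- The forests are counted modulo 2, where paired terms cancel because `1 + 1 = 0`.
  have hsum : ∑ _F : ElimForest H, (1 : ZMod 2) = 0 := by
    refine Finset.sum_involution (fun F _ => σ F) ?_ ?_ (fun _ _ => Finset.mem_univ _) ?_
    · intros
      decide
    · exact fun F _ _ h => hne F (by have := hσ F; rwa [h] at this)
    · exact fun F _ => huniq _ _ _ (hσ (σ F)) (hsymm _ _ (hσ F))
  rw [Finset.sum_const, Finset.card_univ, nsmul_eq_mul, mul_one] at hsum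
  exact (ZMod.natCast_eq_zero_iff_even).1 hsum

theorem conn_comap {V W : Type*} {G : SimpleGraph W} {f : V → W} (hf : Function.Injective f)
    {S : Set W} (hS : Conn G S) (hSf : S ⊆ Set.range f) : Conn (G.comap f) (f ⁻¹' S) := by
  constructor
  · obtain ⟨s, hs⟩ := hS.1
    obtain ⟨v, rfl⟩ := hSf hs
    exact ⟨v, hs⟩
  · rintro A hA ⟨a, ha⟩ hcl x hx
    have := hS.2 (f '' A) (Set.image_subset_iff.2 hA) ⟨f a, a, ha, rfl⟩ (by
      rintro _ ⟨a, ha, rfl⟩ b hb hab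
      obtain ⟨b, rfl⟩ := hSf hb
      exact ⟨b, hcl a ha b hb hab, rfl⟩)
    obtain ⟨y, hy, hyx⟩ := this hx
    exact hf hyx ▸ hy

/-- Remove the vertices from the largest downward: each is simplicial among the remaining smaller
ones, so connectivity survives. `d` bounds the number of removals. -/
theorem IsPEO.conn_inter {G : SimpleGraph (Fin n)} (hG : IsPEO G) {S : Set (Fin n)}
    (hS : Conn G S) (d : ℕ) : ∀ ν, n ≤ ν + d → (S ∩ {v | v.1 < ν}).Nonempty →
      Conn G (S ∩ {v | v.1 < ν}) := by
  have hge : ∀ ν, n ≤ ν → S ∩ {v : Fin n | v.1 < ν} = S := fun ν h =>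
    Set.inter_eq_left.2 fun v _ => v.2.trans_le h
  induction d with
  | zero =>
    intro ν hν _
    rwa [hge ν hν]
  | succ d ih =>
    intro ν hν hne
    by_cases h : n ≤ ν
    · rwa [hge ν h]
    have h : ν < n := not_le.1 h
    have heq : S ∩ {v | v.1 < ν} = (S ∩ {v | v.1 < ν + 1}) \ {⟨ν, h⟩} := by
      ext v
      simp only [Set.mem_inter_iff, Set.mem_ofPred_eq, Set.mem_sdiff, Set.mem_singleton_iff,
        Fin.ext_iff, and_assoc]
      refine and_congr_right fun _ => ?_
      omega
    rw [heq] at hne ⊢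
    refine (ih (ν + 1) (by omega) (hne.mono Set.sdiff_subset)).diff_singleton hne ?_
    have hlt : ∀ a ∈ S ∩ {v : Fin n | v.1 < ν + 1}, G.Adj ⟨ν, h⟩ a → a < ⟨ν, h⟩ := by
      rintro a ⟨-, ha⟩ hadj
      refine lt_of_le_of_ne ?_ hadj.ne'
      exact Fin.le_def.2 (Nat.lt_succ_iff.1 ha)
    intro a ha b hb hma hmb hab
    exact hG ⟨ν, h⟩ (Or.inr ⟨hlt a ha hma, hma⟩) (Or.inr ⟨hlt b hb hmb, hmb⟩) hab

theorem IsPEO.conn_prefix {G : SimpleGraph (Fin n)} (hG : IsPEO G) {S : Set (Fin n)}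
    (hS : Conn G S) {ν : ℕ} (hne : (S ∩ {v | v.1 < ν}).Nonempty) : Conn G (S ∩ {v | v.1 < ν}) :=
  hG.conn_inter hS n ν (by omega) hne

/-- With three vertices available, any two of them are still joined after deleting a suitable third
one. -/
theorem IsTwoConnected.conn_univ {G : SimpleGraph (Fin n)} (hG : IsTwoConnected G) :
    Conn G Set.univ := by
  have h3 := hG.1
  refine ⟨⟨⟨0, by omega⟩, trivial⟩, ?_⟩
  rintro A - ⟨a, ha⟩ hcl x -
  obtain ⟨v, hva, hvx⟩ : ∃ v, v ≠ a ∧ v ≠ x := by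
    by_contra hcon
    push Not at hcon
    have : (Finset.univ : Finset (Fin n)) ⊆ {a, x} := by
      intro v _
      by_cases h : v = a
      · simp [h]
      · simp [hcon v h]
    have h1 := (Finset.card_le_card this).trans Finset.card_le_two
    rw [Finset.card_univ, Fintype.card_fin] at h1
    omega
  have hconn := conn_iff.2 (hG.2 v)
  refine (hconn.2 (A ∩ {v}ᶜ) Set.inter_subset_right ⟨a, ha, hva.symm⟩ ?_ (hvx.symm : x ∈ ({v}ᶜ : Set _))).1
  rintro b ⟨hb, -⟩ c hc hbc
  exact ⟨hcl b hb c trivial hbc, hc⟩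

section Prefix

variable {G : SimpleGraph (Fin n)}

theorem smallerNeighbors_nonempty (hG : IsPEO G) (hconn : Conn G Set.univ) {m : ℕ} (h : m < n)
    (hm : 1 ≤ m) : (smallerNeighbors G ⟨m, h⟩).Nonempty := by
  have hm1 : (⟨m, h⟩ : Fin n) ∈ Set.univ ∩ {v : Fin n | v.1 < m + 1} := ⟨trivial, Nat.lt_succ_self m⟩
  obtain ⟨b, hb, hadj⟩ := (hG.conn_prefix hconn ⟨_, hm1⟩).exists_adj
    (u := ⟨0, by omega⟩) hm1 ⟨trivial, Nat.succ_pos m⟩ (fun h => by simp [Fin.ext_iff] at h; omega)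
  refine ⟨b, lt_of_le_of_ne ?_ hadj.ne', hadj⟩
  exact Fin.le_def.2 (Nat.lt_succ_iff.1 hb.2)

theorem IsTwoConnected.conn_prefix_diff (hG : IsPEO G) (h2 : IsTwoConnected G) {ν : ℕ}
    (hν : 2 ≤ ν) (v : Fin n) : Conn G ({v}ᶜ ∩ {w | w.1 < ν}) := by
  have h3 := h2.1
  refine hG.conn_prefix (conn_iff.2 (h2.2 v)) ?_
  by_cases hv : v.1 = 0
  · exact ⟨⟨1, by omega⟩, fun h => by rw [← show _ = v from h] at hv; simp at hv,
      show 1 < ν by omega⟩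
  · exact ⟨⟨0, by omega⟩, fun h => hv (by rw [← show _ = v from h]), show 0 < ν by omega⟩

/-- This version on `Fin n` drives the induction for cyclicity. The same involution is applied
separately to `prefixGraph`, which avoids a bijection between the two kinds of forests. -/
theorem even_card_cut (hG : IsPEO G) (h2 : IsTwoConnected G) {ν : ℕ} (hν : 2 ≤ ν) :
    Even (Fintype.card (ElimForest (cut G ν))) := by
  have h3 := h2.1
  have hconn : Conn G {w : Fin n | w.1 < ν} := by
    have := hG.conn_prefix h2.conn_univ (ν := ν) ⟨⟨0, by omega⟩, trivial, show 0 < ν by omega⟩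
    rwa [Set.univ_inter] at this
  have hcut : ∀ {S : Set (Fin n)}, Conn G S → S ⊆ {w : Fin n | w.1 < ν} → Conn (cut G ν) S :=
    fun hS hsub => hS.of_adj fun a ha b hb hab => ⟨hab, hsub ha, hsub hb⟩
  refine even_card_elimForest (C := {w : Fin n | w.1 < ν}) ?_ fun v _ => ?_
  · exact isComponent_iff.2 ⟨Set.subset_univ _, hcut hconn subset_rfl, fun a _ b _ hab => hab.2.2⟩
  · refine hcut ?_ Set.sdiff_subset
    have := h2.conn_prefix_diff hG hν v
    rwa [Set.inter_comm, ← Set.sdiff_eq] at this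

theorem even_card_prefixGraph (hG : IsPEO G) (h2 : IsTwoConnected G) {ν : ℕ} (hν : 2 ≤ ν)
    (hνn : ν ≤ n) : Even (Fintype.card (ElimForest (prefixGraph G ν hνn))) := by
  have h3 := h2.1
  have hf := Fin.castLE_injective hνn
  have hrange : {w : Fin n | w.1 < ν} ⊆ Set.range (Fin.castLE hνn) :=
    fun w hw => ⟨⟨w.1, hw⟩, rfl⟩
  refine even_card_elimForest (C := Set.univ) ?_ fun v _ => ?_
  · have := conn_comap hf (hG.conn_prefix h2.conn_univ (ν := ν)
      ⟨⟨0, by omega⟩, trivial, show 0 < ν by omega⟩) (Set.inter_subset_right.trans hrange)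
    refine isComponent_iff.2 ⟨subset_rfl, ?_, fun _ _ _ _ _ => trivial⟩
    change Conn (G.comap (Fin.castLE hνn)) _
    convert this using 1
    ext v
    simp
  · have := conn_comap hf (h2.conn_prefix_diff hG hν (Fin.castLE hνn v))
      (Set.inter_subset_right.trans hrange)
    change Conn (G.comap (Fin.castLE hνn)) _
    convert this using 1
    ext w
    simp

end Prefix

theorem GreedyCode.length_eq {G : SimpleGraph (Fin n)} {M : List (Fin n → Set (Fin n))}
    (h : GreedyCode G M) : M.length = Fintype.card (ElimForest G) := by
  obtain ⟨L, rfl, -, -, hL⟩ := h.exists_list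
  rw [List.length_map, hL]

/-! ### Cyclicity under insertion of a vertex. -/

section Cyclic

variable {H H' : SimpleGraph (Fin n)} {m : Fin n} {N : Set (Fin n)}
  {M : List (Fin n → Set (Fin n))} (E : Extends H H' m N)
include E

theorem Extends.exists_ends (h : GreedyCode H M) : ∃ D D', Nested H D ∧ Nested H D' ∧
    M.head? = some D ∧ M.getLast? = some D' ∧
    (ElimGray.zigzag N m true M).head? = some (extreme N m false D) ∧
    (ElimGray.zigzag N m true M).getLast? = some (extreme N m (!decide (Even M.length)) D') := by
  have hM : ∀ D ∈ M, Nested H D := fun D hD => (h.mem D).1 hD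
  obtain ⟨D, hD, -⟩ := h.head
  cases M with
  | nil => cases hD
  | cons D M =>
    obtain ⟨D', hD'⟩ : ∃ D', (D :: M).getLast? = some D' :=
      ⟨_, List.getLast?_eq_some_getLast (List.cons_ne_nil D M)⟩
    refine ⟨D, D', hM D (by simp), hM D' (List.mem_of_getLast? hD'), rfl, hD',
      E.head_zigzag (hM D (by simp)), ?_⟩
    rw [E.getLast_zigzag hM hD']
    congr 2
    by_cases h : Even (D :: M).length
    · rw [if_pos h]
      simp only [h, decide_true]
    · rw [if_neg h]
      simp only [h, decide_false, Bool.not_false]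

/-- Both ends have `m` as a leaf with set `{m}`. A rotation involving `m` would transfer its set to
the other vertex or conversely, so a closing rotation avoids `m` and projects; the converse is
lifting at the bottom. -/
theorem Extends.cyclic_zigzag_of_even (h : GreedyCode H M) (heven : Even M.length) :
    Cyclic (zigzag N m true M) ↔ Cyclic M := by
  obtain ⟨D, D', hD, hD', h1, h2, h3, h4⟩ := E.exists_ends h
  simp only [heven, decide_true, Bool.not_true] at h4
  simp only [Cyclic, h1, h2, h3, h4, Option.some.injEq, exists_eq_left', exists_and_left]
  constructor
  · rintro ⟨i, j, hedge⟩
    have hm : ∀ D, extreme N m false D m = {m} := by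
      intro D
      simp [extreme, ins]
    have hne : ∀ {D D' i j}, Nested H D → Nested H D' →
        Rot (extreme N m false D) (extreme N m false D') i j → i ≠ m ∧ j ≠ m := by
      intro D D' i j hD hD' h
      have hself := (E.extreme_nested hD false).self
      have hself' := (E.extreme_nested hD' false).self
      constructor
      · rintro rfl
        have := hself' j
        rw [h.2.1, hm] at this
        exact h.1 this.symm
      · rintro rfl
        have := hself i
        rw [← h.2.1, hm] at this
        exact h.1 this
    refine ⟨i, j, ?_⟩
    rw [← E.del_extreme hD false, ← E.del_extreme hD' false]
    rcases hedge with h | h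
    · exact Or.inl (h.del (hne hD hD' h).1 (hne hD hD' h).2)
    · exact Or.inr (h.del (hne hD hD' h).1 (hne hD hD' h).2)
  · rintro ⟨i, j, h⟩
    exact ⟨i, j, E.edge_extreme hD hD' h false⟩

/-- `m` is at the bottom first and at the top last, so its set changes and a closing rotation
involves `m`. Both ends then lie over the same forest, which a duplicate-free list has as first and
last entry only if it is a singleton. -/
theorem Extends.length_eq_one_of_cyclic (h : GreedyCode H M) (hodd : ¬ Even M.length)
    (hc : Cyclic (zigzag N m true M)) : M.length = 1 := by
  obtain ⟨D, D', hD, hD', h1, h2, h3, h4⟩ := E.exists_ends h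
  simp only [hodd, decide_false, Bool.not_false] at h4
  simp only [Cyclic, h3, h4, Option.some.injEq, exists_eq_left', exists_and_left] at hc
  obtain ⟨i, j, hedge⟩ := hc
  have hc1 := E.extreme_nested hD false
  have hc2 := E.extreme_nested hD' true
  have hne : extreme N m true D' m ≠ extreme N m false D m := by
    simp only [extreme, if_true, Bool.false_eq_true, if_false, ins_apply_self]
    obtain ⟨ht, hne⟩ := E.topPosition_mem hD'
    obtain ⟨u, hu⟩ := Set.nonempty_iff_ne_empty.2 hne
    intro heq
    have : u ∈ insert m (∅ : Set (Fin n)) := heq ▸ Set.mem_insert_of_mem m hu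
    have hum : u = m := by simpa using this
    exact E.notMem_position hD' ht (hum ▸ hu)
  have hdel : del m (extreme N m true D') = del m (extreme N m false D) := by
    rcases hedge with h | h
    · by_cases hj : j = m
      · exact E.del_eq_of_rot hc1 hc2 (hj ▸ h)
      by_cases hi : i = m
      · exact (E.del_eq_of_rot hc2 hc1 (hi ▸ h.symm)).symm
      · exact absurd (h.2.2 m (Ne.symm hi) (Ne.symm hj)) hne
    · by_cases hj : i = m
      · exact E.del_eq_of_rot hc1 hc2 (hj ▸ h)
      by_cases hi : j = m
      · exact (E.del_eq_of_rot hc2 hc1 (hi ▸ h.symm)).symm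
      · exact absurd (h.2.2 m (Ne.symm hi) (Ne.symm hj)) hne
  rw [E.del_extreme hD, E.del_extreme hD'] at hdel
  subst hdel
  cases M with
  | nil => cases h1
  | cons A M =>
    obtain rfl : A = D' := by simpa using h1
    have hnodup := h.nodup
    cases M with
    | nil => rfl
    | cons B M =>
      rw [List.getLast?_cons_cons] at h2
      exact absurd (List.mem_of_getLast? h2) (List.nodup_cons.1 hnodup).1

/-- The bottom and top positions of `m` are distinct, so every fiber has at least two members. -/
theorem Extends.length_zigzag_ne_one (h : GreedyCode H M) :
    (ElimGray.zigzag N m true M).length ≠ 1 := by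
  obtain ⟨D, hD, -⟩ := h.head
  cases M with
  | nil => cases hD
  | cons D M =>
    have hD := (h.mem D).1 (by simp)
    intro hlen
    rw [zigzag, List.length_append] at hlen
    have h1 := E.head_fiber hD (b := true)
    have h2 := E.getLast_fiber hD (b := true)
    cases hf : fiber N m true D with
    | nil => rw [hf] at h1; cases h1
    | cons A R =>
      rw [hf] at h1 h2 hlen
      cases R with
      | cons B R => simp only [List.length_cons] at hlen; omega
      | nil =>
        have heq : extreme N m (!true) D = extreme N m true D :=
          (Option.some.inj h1).symm.trans (Option.some.inj h2)
        have heq := congrFun heq m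
        simp only [extreme, if_true, Bool.not_true, Bool.false_eq_true, if_false,
          ins_apply_self] at heq
        obtain ⟨ht, hne⟩ := E.topPosition_mem hD
        obtain ⟨u, hu⟩ := Set.nonempty_iff_ne_empty.2 hne
        have : u ∈ insert m (∅ : Set (Fin n)) := heq ▸ Set.mem_insert_of_mem m hu
        have hum : u = m := by simpa using this
        exact E.notMem_position hD ht (hum ▸ hu)

omit E in
theorem length_zigzag {b : Bool} : (zigzag N m b M).length =
    (M.map fun D => (positions N D).ncard).sum := by
  induction M generalizing b with
  | nil => rfl
  | cons D M ih =>
    rw [zigzag, List.length_append, ih, List.map_cons, List.sum_cons]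
    congr 1
    have : (positionList N D).length = (positions N D).ncard := by
      rw [positionList, List.length_mergeSort, Finset.length_toList,
        Set.ncard_eq_toFinset_card _ (Set.toFinite _)]
    unfold fiber
    split_ifs <;> simp [this]

end Cyclic

/-! ### Small cases and the inductions for cyclicity. -/

theorem grayCode_one {G : SimpleGraph (Fin n)} : grayCode G 1 = [fun v => {v}] := by
  unfold grayCode
  split_ifs with h hne
  · obtain ⟨v, hv, -⟩ := hne
    exact absurd (Fin.lt_def.1 hv) (by simp)
  · rfl
  · rfl

theorem smallerNeighbors_one {G : SimpleGraph (Fin n)} (h : 1 < n)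
    (hne : (smallerNeighbors G ⟨1, h⟩).Nonempty) :
    smallerNeighbors G ⟨1, h⟩ = {⟨0, by omega⟩} := by
  refine (Set.Nonempty.subset_singleton_iff hne).1 ?_
  rintro v ⟨hv, -⟩
  exact Fin.ext (by simpa [Fin.lt_def] using hv)

/-- The base case cannot use the even criterion, as one vertex has a single forest; the two forests
of the edge `{0, 1}` differ in its rotation. -/
theorem cyclic_grayCode_two {G : SimpleGraph (Fin n)} (hG : IsPEO G) (h : 1 < n)
    (hne : (smallerNeighbors G ⟨1, h⟩).Nonempty) : Cyclic (grayCode G 2) := by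
  have E := extends_cut hG h hne
  have hcode := greedyCode_grayCode hG 1 h.le
  have hD : Nested (cut G 1) (fun v => {v}) := (hcode.mem _).1 (by rw [grayCode_one]; simp)
  rw [grayCode_succ h hne, grayCode_one]
  refine ⟨_, _, E.head_zigzag hD, E.getLast_zigzag (D := fun v => {v}) (by simpa using hD) (by simp), ⟨0, by omega⟩,
    ⟨1, h⟩, Or.inl ?_⟩
  have hN := smallerNeighbors_one h hne
  have htop : topPosition (smallerNeighbors G ⟨1, h⟩) (fun v => {v}) = {⟨0, by omega⟩} := by
    rw [hN]
    refine Set.Subset.antisymm (Set.sUnion_subset ?_)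
      (subset_topPosition (Or.inr ⟨⟨0, by omega⟩, rfl, _, rfl, rfl⟩))
    rintro T (rfl | ⟨c, rfl, y, hy, hy'⟩)
    · exact Set.empty_subset _
    · rw [Set.mem_singleton_iff] at hy hy'
      rw [← hy, hy']
  have heven : ¬ Even [fun v : Fin n => ({v} : Set (Fin n))].length := by simp
  simp only [extreme, Bool.not_true, if_neg heven, Bool.false_eq_true, if_false, if_true, htop]
  refine E.rot_ins_ins hD ⟨_, rfl, by rw [hN]; rfl⟩
    (Set.empty_ssubset.2 (Set.singleton_nonempty _)) ?_
  rintro w ⟨y, hy, hy'⟩ -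
  rw [hN] at hy'
  rw [Set.mem_singleton_iff] at hy hy'
  rw [← hy, hy']

theorem cyclic_grayCode {G : SimpleGraph (Fin n)} (hG : IsPEO G) (h2 : IsTwoConnected G) (m : ℕ)
    (hm : 2 ≤ m) : m ≤ n → Cyclic (grayCode G m) := by
  have h3 := h2.1
  induction m, hm using Nat.le_induction with
  | base =>
    exact fun h => cyclic_grayCode_two hG h (smallerNeighbors_nonempty hG h2.conn_univ h le_rfl)
  | succ m hm ih =>
    intro h
    have hne := smallerNeighbors_nonempty hG h2.conn_univ h (by omega)
    have hcode := greedyCode_grayCode hG m (by omega)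
    have heven := even_card_cut hG h2 hm
    rw [← hcode.length_eq] at heven
    rw [grayCode_succ h hne, (extends_cut hG h hne).cyclic_zigzag_of_even hcode heven]
    exact ih (by omega)

/-- In a single edge with root `a`, a new neighbor of `a` goes above `a` or becomes an isolated set
at the bottom of its chain; a new neighbor of `b` can also go between `a` and `b`. -/
theorem ncard_positions {D : Fin n → Set (Fin n)} {a b : Fin n} (hab : a ≠ b) (ha : D a = {a, b})
    (hb : D b = {b}) (hD : ∀ w, w ≠ a → w ≠ b → D w = {w}) :
    (positions {a} D).ncard = 2 ∧ (positions {b} D).ncard = 3 := by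
  have h1 : positions {a} D = {∅, {a, b}} := by
    ext T
    constructor
    · rintro (rfl | ⟨c, rfl, y, hy, rfl⟩)
      · exact Or.inl rfl
      · refine Or.inr ?_
        by_cases hca : c = y
        · rw [hca, ha]; rfl
        by_cases hcb : c = b
        · rw [hcb, hb] at hy
          exact absurd hy hab
        · rw [hD c hca hcb] at hy
          exact absurd hy.symm hca
    · rintro (rfl | rfl)
      · exact Or.inl rfl
      · exact Or.inr ⟨a, ha.symm, a, by simp [ha], rfl⟩
  have h2 : positions {b} D = {∅, {b}, {a, b}} := by
    ext T
    constructor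
    · rintro (rfl | ⟨c, rfl, y, hy, rfl⟩)
      · exact Or.inl rfl
      · refine Or.inr ?_
        by_cases hca : c = a
        · rw [hca, ha]; exact Or.inr rfl
        by_cases hcb : c = y
        · rw [hcb, hb]; exact Or.inl rfl
        · rw [hD c hca hcb] at hy
          exact absurd hy.symm hcb
    · rintro (rfl | rfl | rfl)
      · exact Or.inl rfl
      · exact Or.inr ⟨b, hb.symm, b, by simp [hb], rfl⟩
      · exact Or.inr ⟨a, ha.symm, b, by simp [ha], rfl⟩
  have e1 : (∅ : Set (Fin n)) ≠ {a, b} := (Set.insert_nonempty _ _).ne_empty.symm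
  have e2 : (∅ : Set (Fin n)) ≠ {b} := (Set.singleton_nonempty _).ne_empty.symm
  have e3 : ({b} : Set (Fin n)) ≠ {a, b} := by
    intro h
    have : a ∈ ({b} : Set (Fin n)) := h ▸ Set.mem_insert a _
    exact hab this
  constructor
  · rw [h1, Set.ncard_pair e1]
  · rw [h2, Set.ncard_insert_of_notMem (by simp [e1, e2]), Set.ncard_pair e3]

/-- A tree has no triangle, so vertex `2` has exactly one neighbor among `0` and `1`. That vertex is
the root in one forest of the edge and the leaf in the other, giving `2 + 3` positions. -/
theorem length_grayCode_three {G : SimpleGraph (Fin n)} (hG : IsPEO G) (hT : G.IsTree)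
    (h : 2 < n) : (grayCode G 3).length = 5 := by
  have hconn : Conn G Set.univ := conn_iff.2
    ((SimpleGraph.induceUnivIso G).connected_iff.2 hT.connected)
  have h1 : 1 < n := by omega
  have hne1 := smallerNeighbors_nonempty hG hconn h1 le_rfl
  have hne2 := smallerNeighbors_nonempty hG hconn h (by omega)
  have hN := smallerNeighbors_one h1 hne1
  set z : Fin n := ⟨0, by omega⟩ with hz
  set o : Fin n := ⟨1, h1⟩ with ho
  have hzo : z ≠ o := by simp [hz, ho, Fin.ext_iff]
  have hadj : G.Adj o z := by
    have : z ∈ smallerNeighbors G o := by rw [hN]; rfl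
    exact this.2
  rw [grayCode_succ h hne2, length_zigzag, grayCode_succ h1 hne1, grayCode_one]
  simp only [zigzag, List.append_nil, fiber, if_true, List.map_map]
  have hperm : (positionList (smallerNeighbors G o) (fun v => {v})).Perm [∅, {z}] := by
    refine (List.perm_ext_iff_of_nodup nodup_positionList ?_).2 fun T => ?_
    · simp
    · rw [mem_positionList, hN]
      simp only [List.mem_cons, List.not_mem_nil, or_false]
      constructor
      · rintro (rfl | ⟨c, rfl, y, hy, hy'⟩)
        · exact Or.inl rfl
        · rw [Set.mem_singleton_iff] at hy hy'
          rw [← hy, hy']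
          exact Or.inr rfl
      · rintro (rfl | rfl)
        · exact Or.inl rfl
        · exact Or.inr ⟨z, rfl, z, rfl, rfl⟩
  rw [(hperm.map _).sum_eq]
  simp only [List.map_cons, List.map_nil, List.sum_cons, List.sum_nil, Function.comp]
  have hmem : ∀ {c y : Fin n}, y ∈ ({c} : Set (Fin n)) ∩ smallerNeighbors G o → c = z := by
    rintro c y ⟨hy, hy'⟩
    rw [hN] at hy'
    rw [Set.mem_singleton_iff] at hy hy'
    rw [← hy, hy']
  have hzmem : (({z} : Set (Fin n)) ∩ smallerNeighbors G o).Nonempty := ⟨z, rfl, by rw [hN]; rfl⟩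
  have hother : ∀ T w, w ≠ z → w ≠ o →
      ins (smallerNeighbors G o) o (fun v => {v}) T w = {w} := by
    intro T w hw hwo
    unfold ins
    rw [if_neg hwo, if_neg]
    rintro ⟨-, y, hy⟩
    exact hw (hmem hy)
  have hbot := ncard_positions (D := ins (smallerNeighbors G o) o (fun v => {v}) ∅) hzo
    (by
      unfold ins
      rw [if_neg hzo, if_pos ⟨Set.empty_ssubset.2 (Set.singleton_nonempty z), hzmem⟩]
      exact Set.pair_comm _ _)
    (by rw [ins_apply_self]; simp) (hother ∅)
  have htop := ncard_positions (D := ins (smallerNeighbors G o) o (fun v => {v}) {z}) hzo.symm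
    (by rw [ins_apply_self])
    (by
      unfold ins
      rw [if_neg hzo, if_neg]
      exact fun h => h.1.2 subset_rfl)
    (fun w hw hw' => hother _ w hw' hw)
  have htwo : smallerNeighbors G ⟨2, h⟩ = {z} ∨ smallerNeighbors G ⟨2, h⟩ = {o} := by
    have hsub : ∀ v ∈ smallerNeighbors G ⟨2, h⟩, v = z ∨ v = o := by
      rintro v ⟨hv, -⟩
      have : v.1 < 2 := hv
      rcases Nat.lt_succ_iff_lt_or_eq.1 this with h' | h'
      · exact Or.inl (Fin.ext (Nat.lt_one_iff.1 h'))
      · exact Or.inr (Fin.ext h')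
    have hnot : ¬ (z ∈ smallerNeighbors G ⟨2, h⟩ ∧ o ∈ smallerNeighbors G ⟨2, h⟩) := by
      rintro ⟨⟨-, h1⟩, ⟨-, h2⟩⟩
      exact hT.isAcyclic.cliqueFree le_rfl _
        (SimpleGraph.is3Clique_triple_iff.2 ⟨h1, h2, hadj.symm⟩)
    obtain ⟨v, hv⟩ := hne2
    rcases hsub v hv with rfl | rfl
    · refine Or.inl ((Set.Nonempty.subset_singleton_iff ⟨_, hv⟩).1 fun w hw => ?_)
      rcases hsub w hw with rfl | rfl
      · rfl
      · exact absurd ⟨hv, hw⟩ hnot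
    · refine Or.inr ((Set.Nonempty.subset_singleton_iff ⟨_, hv⟩).1 fun w hw => ?_)
      rcases hsub w hw with rfl | rfl
      · exact absurd ⟨hw, hv⟩ hnot
      · rfl
  rcases htwo with h' | h'
  · rw [h', hbot.1, htop.2, add_zero]
  · rw [h', hbot.2, htop.1, add_zero]

/-- The odd length `5` excludes cyclicity at four vertices. Afterwards an even length transports
non-cyclicity, and an odd one would force a list of length one, which cannot occur after a vertex
has been inserted. -/
theorem not_cyclic_grayCode {G : SimpleGraph (Fin n)} (hG : IsPEO G) (hT : G.IsTree) (m : ℕ)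
    (hm : 4 ≤ m) : m ≤ n → ¬ Cyclic (grayCode G m) := by
  have hconn : Conn G Set.univ := conn_iff.2
    ((SimpleGraph.induceUnivIso G).connected_iff.2 hT.connected)
  induction m, hm using Nat.le_induction with
  | base =>
    intro h hc
    have hne := smallerNeighbors_nonempty hG hconn (show 3 < n from h) (by omega)
    have hlen := length_grayCode_three hG hT (show 2 < n by omega)
    rw [grayCode_succ h hne] at hc
    have := (extends_cut hG h hne).length_eq_one_of_cyclic
      (greedyCode_grayCode hG 3 (by omega)) (by rw [hlen]; decide) hc
    omega
  | succ m hm ih =>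
    intro h hc
    have hne := smallerNeighbors_nonempty hG hconn (show m < n from h) (by omega)
    have hcode := greedyCode_grayCode hG m (by omega)
    rw [grayCode_succ h hne] at hc
    by_cases heven : Even (grayCode G m).length
    · exact ih (by omega) (((extends_cut hG h hne).cyclic_zigzag_of_even hcode heven).1 hc)
    · have hone := (extends_cut hG h hne).length_eq_one_of_cyclic hcode heven hc
      obtain ⟨k, rfl⟩ : ∃ k, m = k + 1 := ⟨m - 1, by omega⟩
      have hk : k < n := by omega
      have hne' := smallerNeighbors_nonempty hG hconn hk (by omega)
      rw [grayCode_succ hk hne'] at hone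
      exact (extends_cut hG hk hne').length_zigzag_ne_one (greedyCode_grayCode hG k hk.le) hone

end ElimGray

theorem theorem3 (n : ℕ) (G : SimpleGraph (Fin n)) (hG : ElimGray.IsPEO G) :
    ElimGray.IsRotationGrayCode (ElimGray.greedyRotations G) ∧
    (ElimGray.IsTwoConnected G →
      ElimGray.IsCyclicList (ElimGray.greedyRotations G) ∧
      ∀ (ν : ℕ) (hν : ν ≤ n), 2 ≤ ν →
        Even (Fintype.card (ElimGray.ElimForest (ElimGray.prefixGraph G ν hν)))) ∧
    (G.IsTree → 4 ≤ n → ¬ ElimGray.IsCyclicList (ElimGray.greedyRotations G)) := by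
  have hcode := ElimGray.greedyCode_grayCode hG n le_rfl
  rw [ElimGray.cut_self] at hcode
  rw [ElimGray.isCyclicList_greedyRotations hcode]
  refine ⟨ElimGray.isRotationGrayCode_greedyRotations hcode, fun h2 => ⟨?_, ?_⟩, fun hT hn => ?_⟩
  · exact ElimGray.cyclic_grayCode hG h2 n (by have := h2.1; omega) le_rfl
  · exact fun ν hν h => ElimGray.even_card_prefixGraph hG h2 h hν
  · exact ElimGray.not_cyclic_grayCode hG hT n hn le_rfl
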